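/- **Setting.** Let $\mathcal P_n=\{(p_1,\dots,p_n): p_1\ge\dots\ge p_n\ge 0,\ \sum_i p_i=1\}$. A joint distribution of $\mathbf p^{(1)},\dots,\mathbf p^{(m)}\in\mathcal P_n$ is a non-negative array $M=[M_{i_1,\dots,i_m}]$, $1\le i_1,\dots,i_m\le n$, such that for all $j$ and $t$ the entries with $i_j=t$ sum to $p^{(j)}_t$. Its entropy is $H(M)=-\sum_x M_x\log M_x$, where $\log=\log_2$ and $0\log 0=0$. **Two distributions.** The algorithm *Min-Entropy-Joint-Distribution* takes $\mathbf p,\mathbf q\in\mathcal P_N$ and builds an $N\times N$ matrix $M$ with row sums $\mathbf p$ and column sums $\mathbf q$, as follows. If, at the largest index where they differ, $\mathbf p$ is smaller than $\mathbf q$, swap them (and transpose the result at the end). Compute $\mathbf z=\mathbf p\wedge\mathbf q$, $z_i=\min\{\sum_{j\le i}p_j,\sum_{j\le i}q_j\}-\sum_{j<i}z_j$, and the inversion points $i_0=N+1>i_1>\dots>i_k=1$, where $i_s$ is the least index below $i_{s-1}$ such that $\sum_{l\ge i}p_l\ge\sum_{l\ge i}q_l$ ($s$ odd), respectively $\le$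 ($s$ even), for all $i_s\le i<i_{s-1}$. Start with $M=0$ and $R=C=0$ (arrays of length $N$). For $s=1,\dots,k$ with $s$ odd: for $j=i_{s-1}-1$ down to $i_s$, scan the cells $R[j+1],\dots,R[i_{s-1}-1]$ in this order and put them into a set $Q$ as long as the sum of the cells taken, including the next one, stays below $q_j$; set $z_j^{(d)}=q_j-\sum_{\ell\in Q}R[\ell]$ and $z_j^{(r)}=z_j-z_j^{(d)}$; for $\ell\in Q$ set $M_{\ell j}\leftarrow R[\ell]$ and $R[\ell]\leftarrow0$; then set $M_{jj}\leftarrow z_j^{(d)}$ and $R[j]\leftarrow z_j^{(r)}$. After this, if $i_s\ne1$, for each $\ell\in[i_s,i_{s-1}-1]$ with $R[\ell]\ne0$ set $M_{\ell,\,i_s-1}\leftarrow R[\ell]$ and $R[\ell]\leftarrow0$. For $s$ even do the same with rows and columns, $\mathbf p$ and $\mathbf q$, and $R$ and $C$ exchanged. **Many distributions.** The algorithm *K-Min-Entropy-Joint-Distribution* takes $\mathbf p^{(1)},\dots,\mathbf p^{(m)}\in\mathcal P_n$, $m\ge1$, and repeats distributions cyclically until there are $2^{\lceil\log m\rceil}$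 of them. They are the leaves of a complete binary tree. Each leaf holds the vector of the components of its distribution, each with its index. Level by level, each inner node applies Min-Entropy-Joint-Distribution to the sorted vectors of its two children (padded with zeros to equal length), and holds the vector of the non-zero entries of the resulting matrix in non-increasing order, each entry with the concatenation of the index vectors of its row and of its column. At the root, the index coordinates of the repeated copies are dropped. The output $M$ is the $m$-dimensional array, initially zero, in which each value at the root is added to the cell named by its index vector. **Theorem.** Let $m\ge 1$ and $\mathbf p^{(1)},\dots,\mathbf p^{(m)}\in\mathcal P_n$. The array $M$ output by K-Min-Entropy-Joint-Distribution is a joint distribution of $\mathbf p^{(1)},\dots,\mathbf p^{(m)}$. A joint distribution $M^*$ of minimum entropy exists, and for every such $M^*$ $$H(M)\le H(M^*)+\lceil\log m\rceil .$$ Moreover, the algorithm is polynomial: there are constants $c,d\in\mathbb N$, independent of $m$, $n$ and of the distributions, such that the list of the root values with their index vectors is computed in at most $c\,(mn)^d$ steps, where arithmetic operations and comparisons of reals and array accesses have unit cost, and the whole run, which also writes out the array $M$ with its $n^m$ cells, takes at most $c\,(mn)^d+n^m$ steps. -/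

import Mathlib

noncomputable section

namespace MinEntropy

/-! ## Probability vectors, joint distributions, entropy -/

/-- `p ∈ 𝒫ₙ`: a probability vector with `n` components in non-increasing order. -/
def IsOrderedDist {n : ℕ} (p : Fin n → ℝ) : Prop :=
  (∀ t, 0 ≤ p t) ∧ Antitone p ∧ ∑ t, p t = 1

/-- The `m`-dimensional array `M` is a joint distribution of `p 0, …, p (m - 1)`: its entries are
non-negative, and for each `i` and `t` the entries with `i`-th index `t` sum to `p i t`. -/
def IsJoint {m n : ℕ} (p : Fin m → Fin n → ℝ) (M : (Fin m → Fin n) → ℝ) : Prop :=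
  (∀ x, 0 ≤ M x) ∧ ∀ i t, ∑ x with x i = t, M x = p i t

/-- Shannon entropy in bits, with `0 log 0 = 0`. -/
def H {ι : Type} [Fintype ι] (M : ι → ℝ) : ℝ := -∑ x, M x * Real.logb 2 (M x)

/-- `M` has minimum entropy among all joint distributions of the `p i`. -/
def IsMinEntropyJoint {m n : ℕ} (p : Fin m → Fin n → ℝ) (M : (Fin m → Fin n) → ℝ) : Prop :=
  IsJoint p M ∧ ∀ N, IsJoint p N → H M ≤ H N

/-! ## Step-counted programs

A program is written in the monad `Timed`, which carries the number of elementary steps next to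
the value. The elementary steps are those of a real random access machine: one addition,
subtraction, minimum or comparison of two reals, one access to a cell of an array, one round of a
loop. Arrays are functions on `ℕ` that are `0` outside of the cells in use; the cells in use are
numbered from `1`. -/

structure Timed (α : Type) where
  val : α
  steps : ℕ

instance : Monad Timed where
  pure a := ⟨a, 0⟩
  bind x f := ⟨(f x.val).val, x.steps + (f x.val).steps⟩

/-- Spend `c` steps. -/
def tick (c : ℕ) : Timed Unit := ⟨(), c⟩

def addR (x y : ℝ) : Timed ℝ := ⟨x + y, 1⟩
def subR (x y : ℝ) : Timed ℝ := ⟨x - y, 1⟩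
def minR (x y : ℝ) : Timed ℝ := ⟨min x y, 1⟩
def ltR (x y : ℝ) : Timed Bool := ⟨decide (x < y), 1⟩
def eqR (x y : ℝ) : Timed Bool := ⟨decide (x = y), 1⟩

/-- A fresh array with `N` zero cells. -/
def newArray (N : ℕ) : Timed (ℕ → ℝ) := ⟨fun _ => 0, N⟩

def rd (A : ℕ → ℝ) (i : ℕ) : Timed ℝ := ⟨A i, 1⟩
def wr (A : ℕ → ℝ) (i : ℕ) (x : ℝ) : Timed (ℕ → ℝ) := ⟨Function.update A i x, 1⟩

/-- A fresh `N × N` zero matrix. -/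
def newMatrix (N : ℕ) : Timed (ℕ → ℕ → ℝ) := ⟨fun _ _ => 0, N * N⟩

def rd2 (M : ℕ → ℕ → ℝ) (i j : ℕ) : Timed ℝ := ⟨M i j, 1⟩
def wr2 (M : ℕ → ℕ → ℝ) (i j : ℕ) (x : ℝ) : Timed (ℕ → ℕ → ℝ) :=
  ⟨Function.update M i (Function.update (M i) j x), 1⟩

/-- The transpose of an `N × N` matrix. -/
def transposeM (N : ℕ) (M : ℕ → ℕ → ℝ) : Timed (ℕ → ℕ → ℝ) := ⟨fun i j => M j i, N * N⟩

/-- `for i in l do s ← body i s`. -/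
def forEach {σ : Type} (body : ℕ → σ → Timed σ) : List ℕ → σ → Timed σ
  | [], s => do
    tick 1
    return s
  | i :: l, s => do
    tick 1
    let s' ← body i s
    forEach body l s'

/-- The indices `lo, lo + 1, …, hi - 1`. -/
def upTo (lo hi : ℕ) : List ℕ := List.range' lo (hi - lo)

/-- The indices `hi - 1, hi - 2, …, lo`. -/
def downTo (hi lo : ℕ) : List ℕ := (upTo lo hi).reverse

/-! ## The algorithm for two distributions -/

/-- The scan of the splitting procedure over the cells in the list: while cells remain and
`sum + A[k] < x`, add `A[k]` to `sum` and `k` to `Q`. Returns the final `sum` and `Q`. -/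
def scan (A : ℕ → ℝ) (x : ℝ) : List ℕ → ℝ → Timed (ℝ × List ℕ)
  | [], sum => do
    tick 1
    return (sum, [])
  | k :: l, sum => do
    tick 1
    let a ← rd A k
    let sum' ← addR sum a
    let go ← ltR sum' x
    if go then
      let r ← scan A x l sum'
      return (r.1, k :: r.2)
    else
      return (sum, [])

/-- Splits `z` as `zd + zr` and selects cells `Q` among `lo, …, hi - 1` of `A` with
`zd + ∑ ℓ ∈ Q, A[ℓ] = x`. -/
def split (z x : ℝ) (A : ℕ → ℝ) (lo hi : ℕ) : Timed (ℝ × ℝ × List ℕ) := do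
  let r ← scan A x (upTo lo hi) 0
  let zd ← subR x r.1
  let zr ← subR z zd
  return (zd, zr, r.2)

/-- With `i` the largest index in `1, …, N` where `p` and `q` differ: is `p[i] < q[i]`? -/
def needsSwap (p q : ℕ → ℝ) : ℕ → Timed Bool
  | 0 => do
    tick 1
    return false
  | i + 1 => do
    tick 1
    let a ← rd p (i + 1)
    let b ← rd q (i + 1)
    let same ← eqR a b
    if same then needsSwap p q i else ltR a b

/-- Cell `i` of the result is `p[i] + ⋯ + p[N]`. -/
def suffixSums (N : ℕ) (p : ℕ → ℝ) : Timed (ℕ → ℝ) := do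
  let S ← newArray (N + 1)
  forEach (fun i S => do
    let a ← rd p i
    let b ← rd S (i + 1)
    let c ← addR a b
    wr S i c) (downTo (N + 1) 1) S

/-- The inversion points `i₁ > i₂ > ⋯ > i_k = 1` of `p` and `q`, from their suffix sums `P` and `Q`.
The scan goes downwards; it is at index `i` of a segment in which `P[i] ≥ Q[i]` (when `odd` is true)
or `P[i] ≤ Q[i]` (when `odd` is false) has to hold, and closes the segment at `i + 1` when the
inequality fails at `i`. -/
def inversionPoints (P Q : ℕ → ℝ) : Bool → ℕ → Timed (List ℕ)
  | _, 0 => do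
    tick 1
    return [1]
  | odd, i + 1 => do
    tick 1
    let a ← rd P (i + 1)
    let b ← rd Q (i + 1)
    let fails ← if odd then ltR a b else ltR b a
    if fails then
      let rest ← inversionPoints P Q (!odd) i
      return (i + 2) :: rest
    else
      inversionPoints P Q odd i

/-- The greatest lower bound `z = p ∧ q` in the majorization order:
`z[i] = min (p[1] + ⋯ + p[i]) (q[1] + ⋯ + q[i]) - (z[1] + ⋯ + z[i - 1])`. The state of the loop is
`(prefix sum of p, prefix sum of q, prefix sum of z, z)`. -/
def glb (N : ℕ) (p q : ℕ → ℝ) : Timed (ℕ → ℝ) := do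
  let z₀ ← newArray N
  let r ← forEach (fun i (s : ℝ × ℝ × ℝ × (ℕ → ℝ)) => do
    let a ← rd p i
    let sp ← addR s.1 a
    let b ← rd q i
    let sq ← addR s.2.1 b
    let mn ← minR sp sq
    let zi ← subR mn s.2.2.1
    let sz ← addR s.2.2.1 zi
    let z ← wr s.2.2.2 i zi
    return (sp, sq, sz, z)) (upTo 1 (N + 1)) (0, 0, 0, z₀)
  return r.2.2.2

/-- The memory of the main loop: the matrix under construction and the auxiliary arrays. -/
structure Mem where
  M : ℕ → ℕ → ℝ
  R : ℕ → ℝ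
  C : ℕ → ℝ

/-- The treatment of the indices `hi - 1, …, lo` when they form a `p`-segment (`s` odd). -/
def pSegment (z q : ℕ → ℝ) (hi lo : ℕ) (st : Mem) : Timed Mem := do
  let st ← forEach (fun j (st : Mem) => do
    let zj ← rd z j
    let qj ← rd q j
    let r ← split zj qj st.R (j + 1) hi
    let st ← forEach (fun l (st : Mem) => do
      let x ← rd st.R l
      let M ← wr2 st.M l j x
      let R ← wr st.R l 0
      return { st with M := M, R := R }) r.2.2 st
    let M ← wr2 st.M j j r.1
    let R ← wr st.R j r.2.1
    return { st with M := M, R := R }) (downTo hi lo) st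
  tick 1
  if lo = 1 then
    return st
  else
    forEach (fun l (st : Mem) => do
      let x ← rd st.R l
      let zero ← eqR x 0
      if zero then
        return st
      else
        let M ← wr2 st.M l (lo - 1) x
        let R ← wr st.R l 0
        return { st with M := M, R := R }) (upTo lo hi) st

/-- The treatment of the indices `hi - 1, …, lo` when they form a `q`-segment (`s` even). -/
def qSegment (z p : ℕ → ℝ) (hi lo : ℕ) (st : Mem) : Timed Mem := do
  let st ← forEach (fun j (st : Mem) => do
    let zj ← rd z j
    let pj ← rd p j
    let r ← split zj pj st.C (j + 1) hi
    let st ← forEach (fun l (st : Mem) => do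
      let x ← rd st.C l
      let M ← wr2 st.M j l x
      let C ← wr st.C l 0
      return { st with M := M, C := C }) r.2.2 st
    let M ← wr2 st.M j j r.1
    let C ← wr st.C j r.2.1
    return { st with M := M, C := C }) (downTo hi lo) st
  tick 1
  if lo = 1 then
    return st
  else
    forEach (fun l (st : Mem) => do
      let x ← rd st.C l
      let zero ← eqR x 0
      if zero then
        return st
      else
        let M ← wr2 st.M (lo - 1) l x
        let C ← wr st.C l 0
        return { st with M := M, C := C }) (upTo lo hi) st

/-- The main loop over the segments `[i_s, i_{s-1} - 1]`; `prev` is `i_{s-1}`, and the list holds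
`i_s, …, i_k`. -/
def mainLoop (p q z : ℕ → ℝ) : Bool → ℕ → List ℕ → Mem → Timed Mem
  | _, _, [], st => do
    tick 1
    return st
  | odd, prev, i :: rest, st => do
    tick 1
    let st' ← if odd then pSegment z q prev i st else qSegment z p prev i st
    mainLoop p q z (!odd) i rest st'

/-- The body of the algorithm, for `p` and `q` in the right order. -/
def orderedMinEntropyJoint (N : ℕ) (p q : ℕ → ℝ) : Timed (ℕ → ℕ → ℝ) := do
  let M ← newMatrix N
  let R ← newArray N
  let C ← newArray N
  let P ← suffixSums N p
  let Q ← suffixSums N q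
  let inv ← inversionPoints P Q true N
  let z ← glb N p q
  let st ← mainLoop p q z true (N + 1) inv ⟨M, R, C⟩
  return st.M

/-- Min-Entropy-Joint-Distribution: for ordered distributions `p[1..N]` and `q[1..N]`, a matrix
with row sums `p` and column sums `q`. When `p` and `q` have been swapped, the result is transposed
at the end, so that the rows belong to `p`. -/
def minEntropyJoint (N : ℕ) (p q : ℕ → ℝ) : Timed (ℕ → ℕ → ℝ) := do
  let sw ← needsSwap p q N
  if sw then
    let M ← orderedMinEntropyJoint N q p
    transposeM N M
  else
    orderedMinEntropyJoint N p q

/-! ## The tree-based algorithm for many distributions -/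

/-- A component of a vector `𝐦^(i-j)` with its index vector `Indices^(i-j)`. -/
abbrev Entry (n : ℕ) : Type := ℝ × List (Fin n)

/-- Insertion into a non-increasingly sorted list. -/
def insertDesc {n : ℕ} (e : Entry n) : List (Entry n) → Timed (List (Entry n))
  | [] => do
    tick 1
    return [e]
  | f :: l => do
    tick 1
    let lt ← ltR e.1 f.1
    if lt then
      let r ← insertDesc e l
      return f :: r
    else
      return e :: f :: l

/-- Sorts into non-increasing order (stable insertion sort). -/
def sortDesc {n : ℕ} : List (Entry n) → Timed (List (Entry n))
  | [] => do
    tick 1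
    return []
  | e :: l => do
    tick 1
    let r ← sortDesc l
    insertDesc e r

/-- The number of entries. -/
def len {n : ℕ} (l : List (Entry n)) : Timed ℕ := ⟨l.length, l.length + 1⟩

/-- The values of the entries as an array, padded with zeros to the cells `1, …, N`. -/
def load {n : ℕ} (N : ℕ) (l : List (Entry n)) : Timed (ℕ → ℝ) :=
  ⟨fun i => (0 :: l.map Prod.fst).getD i 0, N + 1⟩

/-- Concatenation of index vectors. -/
def concat {n : ℕ} (u v : List (Fin n)) : Timed (List (Fin n)) :=
  ⟨u ++ v, u.length + v.length + 1⟩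

/-- The non-zero entries of row `s` of `M`, from column `t` on; `u` is the index vector of the row,
and the list holds the entries for the columns `t, t + 1, …`. -/
def collectRow {n : ℕ} (M : ℕ → ℕ → ℝ) (s : ℕ) (u : List (Fin n)) :
    ℕ → List (Entry n) → Timed (List (Entry n))
  | _, [] => do
    tick 1
    return []
  | t, f :: l => do
    tick 1
    let x ← rd2 M s t
    let zero ← eqR x 0
    if zero then
      collectRow M s u (t + 1) l
    else
      let v ← concat u f.2
      let r ← collectRow M s u (t + 1) l
      return (x, v) :: r

/-- The non-zero entries of `M` from row `s` on; the first list holds the entries for the rows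
`s, s + 1, …`, and `b` the entries for the columns `1, 2, …`. -/
def collect {n : ℕ} (M : ℕ → ℕ → ℝ) (b : List (Entry n)) :
    ℕ → List (Entry n) → Timed (List (Entry n))
  | _, [] => do
    tick 1
    return []
  | s, e :: l => do
    tick 1
    let row ← collectRow M s e.2 1 b
    let r ← collect M b (s + 1) l
    tick row.length
    return row ++ r

/-- The vector of an inner node of the tree, from the vectors of its two children. -/
def mergeNode {n : ℕ} (a b : List (Entry n)) : Timed (List (Entry n)) := do
  let la ← len a
  let lb ← len b
  tick 1
  let N := max la lb
  let p ← load N a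
  let q ← load N b
  let M ← minEntropyJoint N p q
  let c ← collect M b 1 a
  sortDesc c

/-- One level of the tree: the nodes are merged in adjacent pairs. -/
def mergeLevel {n : ℕ} : List (List (Entry n)) → Timed (List (List (Entry n)))
  | a :: b :: l => do
    tick 1
    let c ← mergeNode a b
    let r ← mergeLevel l
    return c :: r
  | l => do
    tick 1
    return l

/-- The loop over the levels of the tree. -/
def mergeLevels {n : ℕ} : ℕ → List (List (Entry n)) → Timed (List (List (Entry n)))
  | 0, l => do
    tick 1
    return l
  | k + 1, l => do
    tick 1
    let l' ← mergeLevel l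
    mergeLevels k l'

/-- The entries of a leaf: component `t` of the distribution, with index vector `⟨t⟩`. -/
def leaf {n : ℕ} (p : Fin n → ℝ) : Timed (List (Entry n)) :=
  ⟨List.ofFn fun t => (p t, [t]), n + 1⟩

/-- The sorted vectors of the leaves, for a list of distributions. -/
def leaves {n : ℕ} : List (Fin n → ℝ) → Timed (List (List (Entry n)))
  | [] => do
    tick 1
    return []
  | p :: l => do
    tick 1
    let a ← leaf p
    let a' ← sortDesc a
    let r ← leaves l
    return a' :: r

/-- Keeps the first `m` coordinates of every index vector. -/
def truncate {n : ℕ} (m : ℕ) : List (Entry n) → Timed (List (Entry n))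
  | [] => do
    tick 1
    return []
  | e :: l => do
    tick (m + 1)
    let r ← truncate m l
    return (e.1, e.2.take m) :: r

/-- K-Min-Entropy-Joint-Distribution, up to the vector of components of the joint distribution and
their index vectors. The number `m` of distributions is rounded up to the power `2 ^ ⌈log₂ m⌉` by
repeating distributions cyclically; the coordinates of the repeated copies are dropped at the end. -/
def kMinEntropyEntries {m n : ℕ} [NeZero m] (p : Fin m → Fin n → ℝ) : Timed (List (Entry n)) := do
  tick (m + 1)
  let κ := Nat.clog 2 m
  let l ← leaves (List.ofFn fun i : Fin (2 ^ κ) => p (Fin.ofNat m i))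
  let l' ← mergeLevels κ l
  truncate m (l'.headD [])

/-- Writes the entries into the `m`-dimensional array `M`. A value is added to its cell: index
vectors can coincide when coordinates of repeated copies have been dropped. -/
def writeEntries {m n : ℕ} : List (Entry n) → ((Fin m → Fin n) → ℝ) →
    Timed ((Fin m → Fin n) → ℝ)
  | [], M => do
    tick 1
    return M
  | e :: l, M => do
    tick (m + 3)
    writeEntries l fun x => if List.ofFn x = e.2 then M x + e.1 else M x

/-- K-Min-Entropy-Joint-Distribution with its output as an `m`-dimensional array, all of whose
`n ^ m` cells are first set to zero. -/
def kMinEntropyJoint {m n : ℕ} [NeZero m] (p : Fin m → Fin n → ℝ) :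
    Timed ((Fin m → Fin n) → ℝ) := do
  let l ← kMinEntropyEntries p
  tick (n ^ m)
  writeEntries l fun _ => 0

end MinEntropy

end

/-! The proof compares vectors by their truncated sums `W_a(t) = ∑ i, min (a i) t`. For vectors with
the same total, `a` majorizes `b` exactly if `W_a(t) ≤ W_b(t)` for all `t ≥ 0`. In this form zero
components and the order of the components do not matter, aggregation visibly decreases `W`, and
splitting every component of `b` into `K` equal parts turns `W_b(t)` into `W_b(K t)`. Since
`∫ s in 0..1, min x (T s) / s = x + x log T - x log x` (`integral_min_div`), the entropy in nats is
`∫ s in 0..1, W(s) / s - 1`, so a comparison of truncated sums is one of entropies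
(`H_le_of_sum_min_le`).

Let `y` be any joint distribution. Its marginals aggregate it, so each of them majorizes it
(`IsJoint.sum_min_le`). The claim, proved upwards through the tree, is that the vector of a node `k`
levels above the leaves majorizes `y` with every component split into `2 ^ k` equal parts (`IsNode`,
`isNode_mergeNode`). There are two ingredients. First, `p ∧ q` is the greatest lower bound for
majorization (`sum_min_meet_le_mul`). Second, the matrix computed for `p` and `q` has these row and
column sums, and its non-zero cells arise by splitting each component of `p ∧ q` into at most two
parts (`minEntropyJoint_spec`), while `min x t + min x' t ≤ min (x + x') (2 t)`. At the root
`k = ⌈log m⌉`, and dropping coordinates only aggregates entries (`sum_min_kMinEntropyJoint_le`).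

For the matrix, both kinds of segments are reduced to `p`-segments by transposition
(`qSegment_val`). Within a `p`-segment, what remains in `R` together with the current component
of `p ∧ q` never falls short of the demand of the current column, because the prefix sums of `p` do
not exceed those of `q` there; and a cell at which the scan stops is at most the current component of
`p ∧ q`, which is non-increasing (`segmentLoopInv_step`). The left-over goes into the column just below the segment and makes up there
for the difference between `q` and `p ∧ q` (`mainLoopInv_pSegment`).

The number of non-zero cells is at most twice the number of components of `p ∧ q`, so the vectors at
level `k` have at most `2 ^ k * n ≤ 2 m n` entries, and crude estimates of all loops give a
polynomial in `m n` (`kMinEntropy_steps_le`). -/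

namespace MinEntropy

/-! ### Step-counted programs and loops -/

section Basics

variable {α β σ : Type}

@[simp] theorem bind_val (x : Timed α) (f : α → Timed β) : (x >>= f).val = (f x.val).val := rfl
@[simp] theorem bind_steps (x : Timed α) (f : α → Timed β) :
    (x >>= f).steps = x.steps + (f x.val).steps := rfl
@[simp] theorem pure_val (a : α) : (pure a : Timed α).val = a := rfl
@[simp] theorem pure_steps (a : α) : (pure a : Timed α).steps = 0 := rfl
@[simp] theorem tick_steps (c : ℕ) : (tick c).steps = c := rfl
@[simp] theorem addR_val (x y : ℝ) : (addR x y).val = x + y := rfl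
@[simp] theorem addR_steps (x y : ℝ) : (addR x y).steps = 1 := rfl
@[simp] theorem subR_val (x y : ℝ) : (subR x y).val = x - y := rfl
@[simp] theorem subR_steps (x y : ℝ) : (subR x y).steps = 1 := rfl
@[simp] theorem minR_val (x y : ℝ) : (minR x y).val = min x y := rfl
@[simp] theorem minR_steps (x y : ℝ) : (minR x y).steps = 1 := rfl
@[simp] theorem ltR_val (x y : ℝ) : (ltR x y).val = decide (x < y) := rfl
@[simp] theorem ltR_steps (x y : ℝ) : (ltR x y).steps = 1 := rfl
@[simp] theorem eqR_val (x y : ℝ) : (eqR x y).val = decide (x = y) := rfl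
@[simp] theorem eqR_steps (x y : ℝ) : (eqR x y).steps = 1 := rfl
@[simp] theorem rd_val (A : ℕ → ℝ) (i : ℕ) : (rd A i).val = A i := rfl
@[simp] theorem rd_steps (A : ℕ → ℝ) (i : ℕ) : (rd A i).steps = 1 := rfl
@[simp] theorem wr_val (A : ℕ → ℝ) (i : ℕ) (x : ℝ) :
    (wr A i x).val = Function.update A i x := rfl
@[simp] theorem wr_steps (A : ℕ → ℝ) (i : ℕ) (x : ℝ) : (wr A i x).steps = 1 := rfl
@[simp] theorem rd2_val (M : ℕ → ℕ → ℝ) (i j : ℕ) : (rd2 M i j).val = M i j := rfl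
@[simp] theorem rd2_steps (M : ℕ → ℕ → ℝ) (i j : ℕ) : (rd2 M i j).steps = 1 := rfl
@[simp] theorem wr2_val (M : ℕ → ℕ → ℝ) (i j : ℕ) (x : ℝ) :
    (wr2 M i j x).val = Function.update M i (Function.update (M i) j x) := rfl
@[simp] theorem wr2_steps (M : ℕ → ℕ → ℝ) (i j : ℕ) (x : ℝ) : (wr2 M i j x).steps = 1 := rfl
@[simp] theorem newArray_val (N : ℕ) : (newArray N).val = fun _ => 0 := rfl
@[simp] theorem newArray_steps (N : ℕ) : (newArray N).steps = N := rfl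
@[simp] theorem newMatrix_val (N : ℕ) : (newMatrix N).val = fun _ _ => 0 := rfl
@[simp] theorem newMatrix_steps (N : ℕ) : (newMatrix N).steps = N * N := rfl
@[simp] theorem transposeM_val (N : ℕ) (M : ℕ → ℕ → ℝ) :
    (transposeM N M).val = fun i j => M j i := rfl
@[simp] theorem transposeM_steps (N : ℕ) (M : ℕ → ℕ → ℝ) : (transposeM N M).steps = N * N := rfl

@[simp] theorem forEach_nil (body : ℕ → σ → Timed σ) (s : σ) : (forEach body [] s).val = s := rfl
@[simp] theorem forEach_cons (body : ℕ → σ → Timed σ) (i : ℕ) (l : List ℕ) (s : σ) :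
    (forEach body (i :: l) s).val = (forEach body l (body i s).val).val := rfl

theorem forEach_append (body : ℕ → σ → Timed σ) (l l' : List ℕ) (s : σ) :
    (forEach body (l ++ l') s).val = (forEach body l' (forEach body l s).val).val := by
  induction l generalizing s with
  | nil => rfl
  | cons i l ih => simp [ih]

theorem upTo_succ_right {lo hi : ℕ} (h : lo ≤ hi) : upTo lo (hi + 1) = upTo lo hi ++ [hi] := by
  unfold upTo
  rw [Nat.succ_sub h, List.range'_concat]
  simp [Nat.add_sub_cancel' h]

theorem upTo_self (lo : ℕ) : upTo lo lo = [] := by simp [upTo]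

@[simp] theorem length_upTo (lo hi : ℕ) : (upTo lo hi).length = hi - lo := by simp [upTo]

@[simp] theorem length_downTo (hi lo : ℕ) : (downTo hi lo).length = hi - lo := by simp [downTo]

theorem mem_upTo {lo hi i : ℕ} : i ∈ upTo lo hi ↔ lo ≤ i ∧ i < hi := by
  simp only [upTo, List.mem_range'_1]; omega

theorem nodup_upTo (lo hi : ℕ) : (upTo lo hi).Nodup := List.nodup_range'

/-- Invariants of ascending loops. -/
theorem forEach_upTo_inv (I : ℕ → σ → Prop) {body : ℕ → σ → Timed σ} {lo hi : ℕ} (hle : lo ≤ hi)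
    {s : σ} (h0 : I lo s) (hs : ∀ i s, lo ≤ i → i < hi → I i s → I (i + 1) (body i s).val) :
    I hi (forEach body (upTo lo hi) s).val := by
  induction hi, hle using Nat.le_induction with
  | base => simpa [upTo_self] using h0
  | succ k hk ih =>
    rw [upTo_succ_right hk, forEach_append]
    exact hs k _ hk (Nat.lt_succ_self k) (ih fun i s h1 h2 h3 => hs i s h1 (by omega) h3)

/-- Invariants of descending loops. -/
theorem forEach_downTo_inv (I : ℕ → σ → Prop) {body : ℕ → σ → Timed σ} {lo hi : ℕ} (hle : lo ≤ hi)
    {s : σ} (h0 : I hi s) (hs : ∀ i s, lo ≤ i → i < hi → I (i + 1) s → I i (body i s).val) :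
    I lo (forEach body (downTo hi lo) s).val := by
  induction hi, hle using Nat.le_induction generalizing s with
  | base => simpa [downTo, upTo_self] using h0
  | succ k hk ih =>
    have : downTo (k + 1) lo = k :: downTo k lo := by simp [downTo, upTo_succ_right hk]
    rw [this, forEach_cons]
    exact ih (hs k s hk (Nat.lt_succ_self k) h0) fun i s h1 h2 h3 => hs i s h1 (by omega) h3

theorem forEach_steps_le {body : ℕ → σ → Timed σ} {B : ℕ} (l : List ℕ)
    (h : ∀ i ∈ l, ∀ s, (body i s).steps ≤ B) (s : σ) :
    (forEach body l s).steps ≤ l.length * (B + 1) + 1 := by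
  induction l generalizing s with
  | nil => simp [forEach]
  | cons i l ih =>
    have h1 := h i (by simp) s
    have h2 := ih (fun i hi => h i (by simp [hi])) (body i s).val
    simp only [forEach, bind_steps, tick_steps, List.length_cons]
    have : (l.length + 1) * (B + 1) = l.length * (B + 1) + (B + 1) := by ring
    omega

/-- A relation between the states of two loops that their bodies preserve. -/
theorem forEach_rel {τ : Type} (f : σ → τ) {body : ℕ → σ → Timed σ} {body' : ℕ → τ → Timed τ}
    (h : ∀ i s, (body' i (f s)).val = f (body i s).val) (l : List ℕ) (s : σ) :
    (forEach body' l (f s)).val = f (forEach body l s).val := by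
  induction l generalizing s with
  | nil => rfl
  | cons i l ih => simp [h, ih]

end Basics

/-! ### The splitting procedure -/

theorem scan_spec (A : ℕ → ℝ) (x : ℝ) (l : List ℕ) (sum : ℝ) :
    (scan A x l sum).val.1 = sum + ((scan A x l sum).val.2.map A).sum ∧
    (scan A x l sum).val.2 <+: l ∧
    ((scan A x l sum).val.1 < x ∨ (scan A x l sum).val.1 = sum) ∧
    ((scan A x l sum).val.2 = l ∨ ∃ k ∈ l, x ≤ (scan A x l sum).val.1 + A k) := by
  induction l generalizing sum with
  | nil => simp [scan]
  | cons k l ih =>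
    by_cases hlt : sum + A k < x
    · obtain ⟨h1, h2, h3, h4⟩ := ih (sum + A k)
      have e : (scan A x (k :: l) sum).val =
          ((scan A x l (sum + A k)).val.1, k :: (scan A x l (sum + A k)).val.2) := by
        simp [scan, hlt]
      rw [e]
      refine ⟨?_, ?_, Or.inl ?_, ?_⟩
      · simp only [List.map_cons, List.sum_cons]; linarith
      · simpa using h2
      · rcases h3 with h3 | h3
        · exact h3
        · simp only; linarith
      · rcases h4 with h4 | ⟨k', hk', h4⟩
        · left; simp [h4]
        · exact Or.inr ⟨k', by simp [hk'], h4⟩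
    · have e : (scan A x (k :: l) sum).val = (sum, []) := by simp [scan, hlt]
      rw [e]
      exact ⟨by simp, by simp, Or.inr rfl, Or.inr ⟨k, by simp, by simpa using hlt⟩⟩

theorem length_scan_le (A : ℕ → ℝ) (x : ℝ) (l : List ℕ) (sum : ℝ) :
    (scan A x l sum).val.2.length ≤ l.length := (scan_spec A x l sum).2.1.length_le

theorem scan_steps_le (A : ℕ → ℝ) (x : ℝ) (l : List ℕ) (sum : ℝ) :
    (scan A x l sum).steps ≤ 4 * l.length + 1 := by
  induction l generalizing sum with
  | nil => simp [scan]
  | cons k l ih =>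
    have := ih (sum + A k)
    by_cases hlt : sum + A k < x
    · simp [scan, hlt]; omega
    · simp [scan, hlt]; omega

/-! ### One segment of the algorithm for two distributions -/

/-- The parts into which `split` divides `z` are non-negative, and together with the selected
cells the first part adds up to `x`. The second part is non-negative for one of two reasons: the
scan stopped at a cell that is at most `z`, or it took all cells and the supply is large enough. -/
theorem split_spec {z x : ℝ} {A : ℕ → ℝ} {lo hi : ℕ}
    (hAz : ∀ l, lo ≤ l → l < hi → A l ≤ z) (hx : 0 ≤ x)
    (hsum : x ≤ z + ∑ l ∈ Finset.Ico lo hi, A l) :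
    let r := (split z x A lo hi).val
    0 ≤ r.1 ∧ 0 ≤ r.2.1 ∧ r.1 + r.2.1 = z ∧ (∑ l ∈ r.2.2.toFinset, A l) + r.1 = x ∧
      r.2.2.Nodup ∧ ∀ l ∈ r.2.2, lo ≤ l ∧ l < hi := by
  obtain ⟨h1, h2, h3, h4⟩ := scan_spec A x (upTo lo hi) 0
  have e : (split z x A lo hi).val = (x - (scan A x (upTo lo hi) 0).val.1,
      z - (x - (scan A x (upTo lo hi) 0).val.1), (scan A x (upTo lo hi) 0).val.2) := rfl
  rw [e]
  generalize (scan A x (upTo lo hi) 0).val = r at *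
  obtain ⟨s, Q⟩ := r
  simp only at *
  have hnd : Q.Nodup := h2.sublist.nodup (nodup_upTo lo hi)
  refine ⟨?_, ?_, by ring, ?_, hnd, fun l hl => mem_upTo.1 (h2.subset hl)⟩
  · rcases h3 with h3 | h3 <;> linarith
  · rcases h4 with h4 | ⟨k, hk, h4⟩
    · have : (Q.map A).sum = ∑ l ∈ Finset.Ico lo hi, A l := by
        rw [← List.sum_toFinset A hnd, h4]
        congr 1
        ext i
        simp [mem_upTo]
      linarith
    · have := hAz k (mem_upTo.1 hk).1 (mem_upTo.1 hk).2
      linarith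
  · rw [List.sum_toFinset A hnd]; linarith

/-- The round for index `j` of the main loop of `pSegment`. -/
noncomputable def pStep (z q : ℕ → ℝ) (hi j : ℕ) (st : Mem) : Timed Mem := do
  let zj ← rd z j
  let qj ← rd q j
  let r ← split zj qj st.R (j + 1) hi
  let st ← forEach (fun l (st : Mem) => do
    let x ← rd st.R l
    let M ← wr2 st.M l j x
    let R ← wr st.R l 0
    return { st with M := M, R := R }) r.2.2 st
  let M ← wr2 st.M j j r.1
  let R ← wr st.R j r.2.1
  return { st with M := M, R := R }

/-- The round for index `l` of the loop of `pSegment` that empties `R` into column `c`. -/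
noncomputable def pFlush (c l : ℕ) (st : Mem) : Timed Mem := do
  let x ← rd st.R l
  let zero ← eqR x 0
  if zero then
    return st
  else
    let M ← wr2 st.M l c x
    let R ← wr st.R l 0
    return { st with M := M, R := R }

theorem pSegment_val (z q : ℕ → ℝ) (hi lo : ℕ) (st : Mem) :
    (pSegment z q hi lo st).val =
      let st₁ := (forEach (pStep z q hi) (downTo hi lo) st).val
      if lo = 1 then st₁ else (forEach (pFlush (lo - 1)) (upTo lo hi) st₁).val := by
  unfold pSegment
  simp only [bind_val]
  split_ifs <;> rfl

theorem move_val (j : ℕ) (Q : List ℕ) (hQ : Q.Nodup) (st : Mem) :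
    (forEach (fun l (st : Mem) => do
      let x ← rd st.R l
      let M ← wr2 st.M l j x
      let R ← wr st.R l 0
      return { st with M := M, R := R }) Q st).val =
    ⟨fun i c => if c = j ∧ i ∈ Q then st.R i else st.M i c,
      fun i => if i ∈ Q then 0 else st.R i, st.C⟩ := by
  induction Q generalizing st with
  | nil => simp
  | cons l Q ih =>
    rw [forEach_cons, ih (List.nodup_cons.1 hQ).2]
    have hl := (List.nodup_cons.1 hQ).1
    simp only [bind_val, pure_val, wr_val, wr2_val, rd_val, Mem.mk.injEq, and_true]
    constructor
    · funext i c
      by_cases hil : i = l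
      · subst hil
        by_cases hc : c = j <;> simp [hl, hc]
      · simp [hil]
    · funext i
      by_cases hil : i = l
      · subst hil; simp
      · simp [hil]

/-- The effect of `pStep` on a column that is still empty, in additive form: `s` is what the
selected cells contribute. -/
theorem pStep_spec {z q : ℕ → ℝ} {hi j N : ℕ} {st : Mem} (hj : 1 ≤ j) (hhi : hi ≤ N + 1)
    (hRz : ∀ l, j < l → l < hi → st.R l ≤ z j) (hq : 0 ≤ q j)
    (hsum : q j ≤ z j + ∑ l ∈ Finset.Ico (j + 1) hi, st.R l)
    (hcol : ∀ i, st.M i j = 0) (hRj : st.R j = 0) :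
    ∃ (s : ℕ → ℝ) (zd zr : ℝ),
      (∀ i, s i = 0 ∨ j < i ∧ i < hi ∧ s i = st.R i) ∧ 0 ≤ zd ∧ 0 ≤ zr ∧ zd + zr = z j ∧
      (∑ i ∈ Finset.Ico 1 (N + 1), s i) + zd = q j ∧ s j = 0 ∧
      (∀ i c, (pStep z q hi j st).val.M i c =
        st.M i c + if c = j then s i + if i = j then zd else 0 else 0) ∧
      (∀ i, (pStep z q hi j st).val.R i = st.R i - s i + if i = j then zr else 0) ∧
      (pStep z q hi j st).val.C = st.C := by
  obtain ⟨h1, h2, h3, h4, h5, h6⟩ := split_spec (lo := j + 1) (fun l h h' => hRz l h h') hq hsum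
  have e : (pStep z q hi j st).val =
      let r := (split (z j) (q j) st.R (j + 1) hi).val
      let M := fun i c => if c = j ∧ i ∈ r.2.2 then st.R i else st.M i c
      ⟨Function.update M j (Function.update (M j) j r.1),
        Function.update (fun i => if i ∈ r.2.2 then 0 else st.R i) j r.2.1, st.C⟩ := by
    simp only [pStep, bind_val, pure_val, wr_val, wr2_val, rd_val, move_val _ _ h5]
  rw [e]
  generalize (split (z j) (q j) st.R (j + 1) hi).val = r at *
  obtain ⟨zd, zr, Q⟩ := r
  simp only at *
  have hjQ : j ∉ Q := fun h => by have := (h6 j h).1; omega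
  refine ⟨fun i => if i ∈ Q then st.R i else 0, zd, zr, fun i => ?_, h1, h2, h3, ?_, by simp [hjQ],
    fun i c => ?_, fun i => ?_, trivial⟩
  · by_cases hi : i ∈ Q
    · right; have := h6 i hi; simp [hi]; omega
    · simp [hi]
  · rw [← h4, ← Finset.sum_filter]
    congr 2
    ext i
    simp only [Finset.mem_filter, Finset.mem_Ico, List.mem_toFinset]
    refine ⟨fun h => h.2, fun h => ⟨?_, h⟩⟩
    have := h6 i h; omega
  · by_cases hij : i = j
    · subst hij
      by_cases hc : c = i
      · subst hc; simp [hjQ, hcol]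
      · simp [hc]
    · by_cases hc : c = j
      · subst hc; by_cases hiQ : i ∈ Q <;> simp [hij, hiQ, hcol]
      · simp [hij, hc]
  · by_cases hij : i = j
    · subst hij; simp [hjQ, hRj]
    · by_cases hiQ : i ∈ Q <;> simp [hij, hiQ]

/-- The sum of `φ` over the cells of an `N × N` matrix. -/
def cellSum (N : ℕ) (φ : ℝ → ℝ) (M : ℕ → ℕ → ℝ) : ℝ :=
  ∑ i ∈ Finset.Ico 1 (N + 1), ∑ c ∈ Finset.Ico 1 (N + 1), φ (M i c)

theorem cellSum_transpose (N : ℕ) (φ : ℝ → ℝ) (M : ℕ → ℕ → ℝ) :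
    cellSum N φ (fun i c => M c i) = cellSum N φ M := Finset.sum_comm

/-- The invariant of the main loop of `pSegment` once the indices from `j` on are done, for a
segment that starts with the matrix `M₀`. The last field bounds the sum of a function `φ` over all
cells: each index `i` creates just two new values, and they add up to `z i`. -/
structure SegmentLoopInv (N hi : ℕ) (z q : ℕ → ℝ) (φ : ℝ → ℝ) (B : ℕ → ℝ) (st₀ : Mem) (j : ℕ)
    (st : Mem) : Prop where
  M_nonneg : ∀ i c, 0 ≤ st.M i c
  R_nonneg : ∀ i, 0 ≤ st.R i
  R_le : ∀ i, st.R i ≤ z i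
  R_zero : ∀ i, i < j ∨ hi ≤ i → st.R i = 0
  col_zero : ∀ i c, c < j → st.M i c = 0
  M_old : ∀ i c, i < j ∨ hi ≤ i ∨ hi ≤ c → st.M i c = st₀.M i c
  row : ∀ i, (∑ c ∈ Finset.Ico 1 (N + 1), st.M i c) + st.R i =
    (∑ c ∈ Finset.Ico 1 (N + 1), st₀.M i c) + if j ≤ i ∧ i < hi then z i else 0
  col : ∀ c, j ≤ c → c < hi → ∑ i ∈ Finset.Ico 1 (N + 1), st.M i c = q c
  R_sum : ∑ i ∈ Finset.Ico j hi, st.R i = ∑ i ∈ Finset.Ico j hi, (z i - q i)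
  C_eq : st.C = st₀.C
  potential : cellSum N φ st.M + ∑ i ∈ Finset.Ico 1 (N + 1), φ (st.R i) ≤
    cellSum N φ st₀.M + ∑ i ∈ Finset.Ico j hi, B i

theorem segmentLoopInv_step {N lo hi : ℕ} {z q : ℕ → ℝ} {φ : ℝ → ℝ} {B : ℕ → ℝ} {st₀ st : Mem}
    {j : ℕ} (hlo : 1 ≤ lo) (hhi : hi ≤ N + 1)
    (hanti : ∀ i k, lo ≤ i → i ≤ k → k < hi → z k ≤ z i) (hq : ∀ i, 0 ≤ q i)
    (hsum : ∀ j, lo ≤ j → j < hi → ∑ i ∈ Finset.Ico j hi, q i ≤ ∑ i ∈ Finset.Ico j hi, z i)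
    (hφ : φ 0 = 0)
    (hB : ∀ i, lo ≤ i → i < hi → ∀ x y, 0 ≤ x → 0 ≤ y → x + y = z i → φ x + φ y ≤ B i)
    (hj : lo ≤ j) (hj' : j < hi) (h : SegmentLoopInv N hi z q φ B st₀ (j + 1) st) :
    SegmentLoopInv N hi z q φ B st₀ j (pStep z q hi j st).val := by
  have hRj : st.R j = 0 := h.R_zero j (Or.inl (Nat.lt_succ_self j))
  have hs := hsum j hj hj'
  rw [Finset.sum_eq_sum_Ico_succ_bot hj', Finset.sum_eq_sum_Ico_succ_bot hj'] at hs
  have hRs := h.R_sum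
  rw [Finset.sum_sub_distrib] at hRs
  obtain ⟨s, zd, zr, hs1, hzd, hzr, hzz, hsq, hsj, hM', hR', hC'⟩ :=
    pStep_spec (z := z) (q := q) (N := N) (hlo.trans hj) hhi
      (fun l h1 h2 => (h.R_le l).trans (hanti j l hj h1.le h2)) (hq j) (by linarith)
      (fun i => h.col_zero i j (Nat.lt_succ_self j)) hRj
  have hs0 : ∀ i, 0 ≤ s i := fun i => by
    rcases hs1 i with h' | ⟨-, -, h'⟩ <;> rw [h']
    exact h.R_nonneg i
  have hsR : ∀ i, s i ≤ st.R i := fun i => by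
    rcases hs1 i with h' | ⟨-, -, h'⟩ <;> rw [h']
    exact h.R_nonneg i
  have hsz : ∀ i, i ≤ j ∨ hi ≤ i → s i = 0 := fun i hi => by
    rcases hs1 i with h' | ⟨h1, h2, -⟩
    · exact h'
    · omega
  have hjm : j ∈ Finset.Ico 1 (N + 1) := Finset.mem_Ico.2 ⟨hlo.trans hj, by omega⟩
  refine ⟨fun i c => ?_, fun i => ?_, fun i => ?_, fun i hi => ?_, fun i c hc => ?_, fun i c hic => ?_,
    fun i => ?_, fun c hc hc' => ?_, ?_, hC'.trans h.C_eq, ?_⟩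
  · rw [hM']
    have := h.M_nonneg i c
    have := hs0 i
    split_ifs <;> linarith
  · rw [hR']
    have := hsR i
    split_ifs <;> linarith
  · rw [hR']
    split_ifs with hij
    · subst hij; rw [hRj, hsj]; linarith
    · have := h.R_le i; have := hs0 i; linarith
  · rw [hR', h.R_zero i (by omega), hsz i (by omega), if_neg (by omega)]; simp
  · rw [hM', h.col_zero i c (by omega), if_neg (by omega)]; simp
  · rw [hM', h.M_old i c (by omega)]
    split_ifs with h1 h2
    · omega
    · rw [hsz i (by omega)]; simp
    · simp
  · have := h.row i
    simp only [hM', hR', Finset.sum_add_distrib, Finset.sum_ite_eq', hjm, if_true]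
    by_cases hij : i = j
    · subst hij
      rw [if_neg (by omega)] at this
      rw [if_pos rfl, if_pos rfl, if_pos ⟨le_refl _, hj'⟩]
      linarith
    · have e : (j + 1 ≤ i ∧ i < hi) ↔ (j ≤ i ∧ i < hi) := by omega
      simp only [e] at this
      rw [if_neg hij, if_neg hij]
      linarith
  · simp only [hM', Finset.sum_add_distrib]
    by_cases hcj : c = j
    · subst hcj
      simp only [if_true, Finset.sum_add_distrib, Finset.sum_ite_eq', hjm]
      rw [Finset.sum_eq_zero fun i _ => h.col_zero i c (Nat.lt_succ_self c)]
      linarith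
    · simp only [hcj, if_false, Finset.sum_const_zero, add_zero]
      exact h.col c (by omega) hc'
  · have e1 : ∑ i ∈ Finset.Ico (j + 1) hi, (pStep z q hi j st).val.R i =
        ∑ i ∈ Finset.Ico (j + 1) hi, st.R i - ∑ i ∈ Finset.Ico (j + 1) hi, s i := by
      rw [← Finset.sum_sub_distrib]
      refine Finset.sum_congr rfl fun i hi => ?_
      rw [hR', if_neg (by have := Finset.mem_Ico.1 hi; omega), add_zero]
    have e2 : ∑ i ∈ Finset.Ico 1 (N + 1), s i = ∑ i ∈ Finset.Ico (j + 1) hi, s i := by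
      symm
      refine Finset.sum_subset (fun i hi => ?_) fun i _ hi' => hsz i ?_
      · have := Finset.mem_Ico.1 hi; rw [Finset.mem_Ico]; omega
      · rw [Finset.mem_Ico] at hi'; omega
    rw [Finset.sum_eq_sum_Ico_succ_bot hj', Finset.sum_eq_sum_Ico_succ_bot hj', e1, h.R_sum, hR',
      hRj, hsj, if_pos rfl]
    linarith
  · have hp := h.potential
    have e1 : cellSum N φ (pStep z q hi j st).val.M =
        cellSum N φ st.M + ∑ i ∈ Finset.Ico 1 (N + 1), φ (s i) + φ zd := by
      have : ∀ i c, φ ((pStep z q hi j st).val.M i c) =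
          φ (st.M i c) + if c = j then φ (s i) + if i = j then φ zd else 0 else 0 := by
        intro i c
        rw [hM']
        by_cases hc : c = j
        · subst hc
          rw [h.col_zero i c (Nat.lt_succ_self c), hφ]
          by_cases hij : i = c
          · subst hij; simp [hsj, hφ]
          · simp [hij]
        · simp [hc]
      simp only [cellSum, this, Finset.sum_add_distrib, Finset.sum_ite_eq', hjm, if_true]
      ring
    have e2 : ∑ i ∈ Finset.Ico 1 (N + 1), φ ((pStep z q hi j st).val.R i) =
        ∑ i ∈ Finset.Ico 1 (N + 1), φ (st.R i) - ∑ i ∈ Finset.Ico 1 (N + 1), φ (s i) + φ zr := by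
      have : ∀ i, φ ((pStep z q hi j st).val.R i) =
          φ (st.R i) - φ (s i) + if i = j then φ zr else 0 := by
        intro i
        rw [hR']
        by_cases hij : i = j
        · subst hij; simp [hsj, hφ, hRj]
        · rcases hs1 i with h' | ⟨-, -, h'⟩ <;> simp [hij, h', hφ]
      simp only [this, Finset.sum_add_distrib, Finset.sum_sub_distrib, Finset.sum_ite_eq', hjm,
        if_true]
    rw [e1, e2, Finset.sum_eq_sum_Ico_succ_bot hj']
    have := hB j hj hj' zd zr hzd hzr hzz
    linarith

theorem flush_val (d lo hi : ℕ) (hle : lo ≤ hi) (st : Mem) (hcol : ∀ i, st.M i d = 0) :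
    (∀ i c, (forEach (pFlush d) (upTo lo hi) st).val.M i c =
      st.M i c + if c = d then if lo ≤ i ∧ i < hi then st.R i else 0 else 0) ∧
    (∀ i, (forEach (pFlush d) (upTo lo hi) st).val.R i = if lo ≤ i ∧ i < hi then 0 else st.R i) ∧
    (forEach (pFlush d) (upTo lo hi) st).val.C = st.C := by
  refine forEach_upTo_inv (fun k (st' : Mem) =>
    (∀ i c, st'.M i c = st.M i c + if c = d then if lo ≤ i ∧ i < k then st.R i else 0 else 0) ∧
    (∀ i, st'.R i = if lo ≤ i ∧ i < k then 0 else st.R i) ∧ st'.C = st.C) hle ?_ ?_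
  · refine ⟨fun i c => ?_, fun i => ?_, rfl⟩
    · rw [if_neg (c := lo ≤ i ∧ i < lo) (by omega)]; simp
    · rw [if_neg (by omega)]
  · rintro k st' h1 h2 ⟨hM, hR, hC⟩
    have hRk : st'.R k = st.R k := by rw [hR, if_neg (by omega)]
    have hlt : ∀ i, i ≠ k → ((lo ≤ i ∧ i < k + 1) ↔ (lo ≤ i ∧ i < k)) := by omega
    have hkk : lo ≤ k ∧ k < k + 1 := by omega
    by_cases h0 : st.R k = 0
    · have e : (pFlush d k st').val = st' := by simp [pFlush, hRk, h0]
      rw [e]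
      refine ⟨fun i c => ?_, fun i => ?_, hC⟩
      · rw [hM]
        by_cases hik : i = k
        · subst hik; simp [h0]
        · simp only [hlt i hik]
      · rw [hR]
        by_cases hik : i = k
        · subst hik; simp [h0]
        · simp only [hlt i hik]
    · have e : (pFlush d k st').val =
          ⟨Function.update st'.M k (Function.update (st'.M k) d (st.R k)),
            Function.update st'.R k 0, st'.C⟩ := by
        simp [pFlush, hRk, h0]
      rw [e]
      refine ⟨fun i c => ?_, fun i => ?_, hC⟩
      · by_cases hik : i = k
        · subst hik
          by_cases hc : c = d
          · subst hc; simp [hcol, h1]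
          · simp [hc, hM]
        · simp only [ne_eq, hik, not_false_eq_true, Function.update_of_ne, hM, hlt i hik]
      · by_cases hik : i = k
        · subst hik; simp [h1]
        · simp only [ne_eq, hik, not_false_eq_true, Function.update_of_ne, hR, hlt i hik]

/-- What `pSegment` does to a matrix whose columns below `hi` are empty: the columns of the segment
get their sums `q`, its rows grow by `z`, and what is left over goes into column `lo - 1`. -/
theorem pSegment_spec {N lo hi : ℕ} {z q : ℕ → ℝ} {φ : ℝ → ℝ} {B : ℕ → ℝ} {st : Mem}
    (hlo : 1 ≤ lo) (hle : lo ≤ hi) (hhi : hi ≤ N + 1) (hz : ∀ i, 0 ≤ z i)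
    (hanti : ∀ i k, lo ≤ i → i ≤ k → k < hi → z k ≤ z i) (hq : ∀ i, 0 ≤ q i)
    (hsum : ∀ j, lo ≤ j → j < hi → ∑ i ∈ Finset.Ico j hi, q i ≤ ∑ i ∈ Finset.Ico j hi, z i)
    (hone : lo = 1 → ∑ i ∈ Finset.Ico lo hi, q i = ∑ i ∈ Finset.Ico lo hi, z i)
    (hφ : φ 0 = 0)
    (hB : ∀ i, lo ≤ i → i < hi → ∀ x y, 0 ≤ x → 0 ≤ y → x + y = z i → φ x + φ y ≤ B i)
    (hM : ∀ i c, 0 ≤ st.M i c) (hcol : ∀ i c, c < hi → st.M i c = 0) (hR : ∀ i, st.R i = 0) :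
    let st' := (pSegment z q hi lo st).val
    (∀ i c, 0 ≤ st'.M i c) ∧ (∀ i, st'.R i = 0) ∧ st'.C = st.C ∧
    (∀ i c, c + 1 < lo → st'.M i c = 0) ∧
    (lo ≠ 1 → ∑ i ∈ Finset.Ico 1 (N + 1), st'.M i (lo - 1) = ∑ i ∈ Finset.Ico lo hi, (z i - q i)) ∧
    (∀ c, lo ≤ c → c < hi → ∑ i ∈ Finset.Ico 1 (N + 1), st'.M i c = q c) ∧
    (∀ i c, i < lo ∨ hi ≤ i ∨ hi ≤ c → st'.M i c = st.M i c) ∧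
    (∀ i, lo ≤ i → i < hi → ∑ c ∈ Finset.Ico 1 (N + 1), st'.M i c =
      (∑ c ∈ Finset.Ico 1 (N + 1), st.M i c) + z i) ∧
    cellSum N φ st'.M ≤ cellSum N φ st.M + ∑ i ∈ Finset.Ico lo hi, B i := by
  have h : SegmentLoopInv N hi z q φ B st lo
      (forEach (pStep z q hi) (downTo hi lo) st).val := by
    refine forEach_downTo_inv (SegmentLoopInv N hi z q φ B st) hle ?_ fun j s h1 h2 h3 =>
      segmentLoopInv_step hlo hhi hanti hq hsum hφ hB h1 h2 h3
    refine ⟨hM, fun i => (hR i).ge, fun i => (hR i).trans_le (hz i), fun i _ => hR i, hcol,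
      fun _ _ _ => rfl, fun i => ?_, fun c _ _ => by omega, by simp, rfl, by simp [hR, hφ]⟩
    rw [hR, if_neg (by omega)]
  rw [pSegment_val]
  generalize (forEach (pStep z q hi) (downTo hi lo) st).val = s at h
  by_cases h1 : lo = 1
  · simp only [h1, if_true]
    have hRs : ∑ i ∈ Finset.Ico lo hi, s.R i = 0 := by
      rw [h.R_sum, Finset.sum_sub_distrib, hone h1, sub_self]
    have hR0 : ∀ i, s.R i = 0 := fun i => by
      by_cases hi' : lo ≤ i ∧ i < hi
      · exact (Finset.sum_eq_zero_iff_of_nonneg fun i _ => h.R_nonneg i).1 hRs i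
          (Finset.mem_Ico.2 hi')
      · exact h.R_zero i (by omega)
    refine ⟨h.M_nonneg, hR0, h.C_eq, fun i c hc => by omega, fun h' => absurd rfl h',
      fun c hc => h.col c (by omega), fun i c hi => h.M_old i c (by omega), fun i hi hi' => ?_, ?_⟩
    · have := h.row i
      rwa [hR0, add_zero, if_pos (by omega)] at this
    · have := h.potential
      simpa [hR0, hφ, h1] using this
  · simp only [h1, if_false]
    have hcol0 : ∀ i, s.M i (lo - 1) = 0 := fun i => h.col_zero i _ (by omega)
    obtain ⟨hM', hR', hC'⟩ := flush_val (lo - 1) lo hi hle s hcol0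
    generalize (forEach (pFlush (lo - 1)) (upTo lo hi) s).val = s' at hM' hR' hC'
    have hlm : lo - 1 ∈ Finset.Ico 1 (N + 1) := Finset.mem_Ico.2 (by omega)
    have hseg : ∀ f : ℕ → ℝ, ∑ i ∈ Finset.Ico 1 (N + 1), (if lo ≤ i ∧ i < hi then f i else 0) =
        ∑ i ∈ Finset.Ico lo hi, f i := fun f => by
      rw [← Finset.sum_filter]
      congr 1
      ext i
      simp only [Finset.mem_filter, Finset.mem_Ico]
      omega
    refine ⟨fun i c => ?_, fun i => ?_, hC'.trans h.C_eq, fun i c hc => ?_, fun _ => ?_,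
      fun c hc hc' => ?_, fun i c hic => ?_, fun i hi hi' => ?_, ?_⟩
    · rw [hM']
      have := h.M_nonneg i c
      have := h.R_nonneg i
      split_ifs <;> linarith
    · rw [hR']
      split_ifs with h2
      · rfl
      · exact h.R_zero i (by omega)
    · rw [hM', h.col_zero i c (by omega), if_neg (by omega), add_zero]
    · simp only [hM', hcol0, zero_add, if_true, hseg]
      exact h.R_sum
    · simp only [hM', if_neg (show c ≠ lo - 1 by omega), add_zero]
      exact h.col c hc hc'
    · rw [hM', h.M_old i c hic]
      split_ifs with h2 h3
      · omega
      · simp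
      · simp
    · have := h.row i
      rw [if_pos ⟨hi, hi'⟩] at this
      simp only [hM', Finset.sum_add_distrib, Finset.sum_ite_eq', hlm, if_true, hi, hi', and_self]
      exact this
    · have hp := h.potential
      have hRz : ∑ i ∈ Finset.Ico 1 (N + 1), φ (s.R i) = ∑ i ∈ Finset.Ico lo hi, φ (s.R i) := by
        rw [← hseg]
        refine Finset.sum_congr rfl fun i _ => ?_
        split_ifs with h2
        · rfl
        · rw [h.R_zero i (by omega), hφ]
      have : ∀ i c, φ (s'.M i c) = φ (s.M i c) +
          if c = lo - 1 then if lo ≤ i ∧ i < hi then φ (s.R i) else 0 else 0 := by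
        intro i c
        rw [hM']
        by_cases hc : c = lo - 1
        · subst hc
          rw [hcol0, hφ]
          split_ifs <;> simp [hφ]
        · simp [hc]
      have e : cellSum N φ s'.M = cellSum N φ s.M + ∑ i ∈ Finset.Ico lo hi, φ (s.R i) := by
        simp only [cellSum, this, Finset.sum_add_distrib, Finset.sum_ite_eq', hlm, if_true, hseg]
      linarith

/-! ### Correctness of the algorithm for two distributions -/

/-- The sum of the components of `p` with indices `1, …, k - 1`. -/
def prefixSum (p : ℕ → ℝ) (k : ℕ) : ℝ := ∑ i ∈ Finset.Ico 1 k, p i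

theorem prefixSum_one (p : ℕ → ℝ) : prefixSum p 1 = 0 := by simp [prefixSum]

theorem prefixSum_succ (p : ℕ → ℝ) {k : ℕ} (hk : 1 ≤ k) :
    prefixSum p (k + 1) = prefixSum p k + p k := Finset.sum_Ico_succ_top hk p

theorem sum_Ico_eq_prefixSum_sub (p : ℕ → ℝ) {j k : ℕ} (hj : 1 ≤ j) (hk : j ≤ k) :
    ∑ i ∈ Finset.Ico j k, p i = prefixSum p k - prefixSum p j := by
  rw [prefixSum, prefixSum, ← Finset.sum_Ico_consecutive p hj hk]; ring

/-- The component `i ≥ 1` of `p ∧ q`. -/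
def meet (p q : ℕ → ℝ) (i : ℕ) : ℝ :=
  min (prefixSum p (i + 1)) (prefixSum q (i + 1)) - min (prefixSum p i) (prefixSum q i)

theorem meet_comm (p q : ℕ → ℝ) (i : ℕ) : meet p q i = meet q p i := by
  simp only [meet, min_comm]

/-- `p` is non-negative, non-increasing from index `1` on, and zero beyond `N`. -/
structure IsOrderedArray (N : ℕ) (p : ℕ → ℝ) : Prop where
  nonneg : ∀ i, 0 ≤ p i
  anti : ∀ i, 1 ≤ i → p (i + 1) ≤ p i
  zero : ∀ i, N < i → p i = 0

theorem IsOrderedArray.prefixSum_mono {N : ℕ} {p : ℕ → ℝ} (hp : IsOrderedArray N p) {j k : ℕ}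
    (h : j ≤ k) : prefixSum p j ≤ prefixSum p k :=
  Finset.sum_le_sum_of_subset_of_nonneg (Finset.Ico_subset_Ico_right h) fun i _ _ => hp.nonneg i

theorem IsOrderedArray.prefixSum_eq {N : ℕ} {p : ℕ → ℝ} (hp : IsOrderedArray N p) {k : ℕ}
    (h : N + 1 ≤ k) : prefixSum p k = prefixSum p (N + 1) := by
  induction k, h using Nat.le_induction with
  | base => rfl
  | succ k hk ih => rw [prefixSum_succ p (by omega), ih, hp.zero k (by omega), add_zero]

theorem meet_nonneg {N : ℕ} {p q : ℕ → ℝ} (hp : IsOrderedArray N p) (hq : IsOrderedArray N q)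
    (i : ℕ) : 0 ≤ meet p q i :=
  sub_nonneg.2 (min_le_min (hp.prefixSum_mono (Nat.le_succ i)) (hq.prefixSum_mono (Nat.le_succ i)))

/-- `p ∧ q` is non-increasing, since a minimum of concave functions is concave. -/
theorem meet_anti {N : ℕ} {p q : ℕ → ℝ} (hp : IsOrderedArray N p) (hq : IsOrderedArray N q)
    {i k : ℕ} (hi : 1 ≤ i) (hk : i ≤ k) : meet p q k ≤ meet p q i := by
  induction k, hk using Nat.le_induction with
  | base => rfl
  | succ k hk ih =>
    refine le_trans ?_ ih
    have p1 := prefixSum_succ p (hi.trans hk)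
    have p2 := prefixSum_succ p (k := k + 1) (by omega)
    have p3 := hp.anti k (hi.trans hk)
    have q1 := prefixSum_succ q (hi.trans hk)
    have q2 := prefixSum_succ q (k := k + 1) (by omega)
    have q3 := hq.anti k (hi.trans hk)
    unfold meet
    have a1 := min_le_left (prefixSum p (k + 1 + 1)) (prefixSum q (k + 1 + 1))
    have a2 := min_le_right (prefixSum p (k + 1 + 1)) (prefixSum q (k + 1 + 1))
    have a3 := min_le_left (prefixSum p k) (prefixSum q k)
    have a4 := min_le_right (prefixSum p k) (prefixSum q k)
    rcases min_cases (prefixSum p (k + 1)) (prefixSum q (k + 1)) with ⟨h, -⟩ | ⟨h, -⟩ <;>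
      rw [h] <;> linarith

theorem sum_meet (p q : ℕ → ℝ) {j k : ℕ} (hk : j ≤ k) :
    ∑ i ∈ Finset.Ico j k, meet p q i =
      min (prefixSum p k) (prefixSum q k) - min (prefixSum p j) (prefixSum q j) :=
  Finset.sum_Ico_sub (fun i => min (prefixSum p i) (prefixSum q i)) hk

theorem suffixSums_val {N i : ℕ} (p : ℕ → ℝ) (h1 : 1 ≤ i) (h2 : i ≤ N + 1) :
    (suffixSums N p).val i = ∑ l ∈ Finset.Ico i (N + 1), p l := by
  simp only [suffixSums, bind_val, newArray_val]
  have h := forEach_downTo_inv (lo := 1) (hi := N + 1) (σ := ℕ → ℝ) (s := fun _ => 0)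
    (body := fun i S => do
      let a ← rd p i
      let b ← rd S (i + 1)
      let c ← addR a b
      wr S i c)
    (fun j S => ∀ i, j ≤ i → i ≤ N + 1 → S i = ∑ l ∈ Finset.Ico i (N + 1), p l) (by omega)
    (fun i h1 h2 => by
      obtain rfl : i = N + 1 := by omega
      simp)
    (fun j S hj hj' h i hi hi' => by
      simp only [bind_val, rd_val, addR_val, wr_val]
      by_cases hij : i = j
      · subst hij
        rw [Function.update_self, h _ le_rfl (by omega), Finset.sum_eq_sum_Ico_succ_bot hj']
      · rw [Function.update_of_ne hij]
        exact h i (by omega) hi')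
  exact h i h1 h2

theorem glb_val {N i : ℕ} (p q : ℕ → ℝ) :
    (glb N p q).val i = if 1 ≤ i ∧ i ≤ N then meet p q i else 0 := by
  simp only [glb, bind_val, newArray_val, pure_val]
  have h := forEach_upTo_inv (lo := 1) (hi := N + 1) (σ := ℝ × ℝ × ℝ × (ℕ → ℝ))
    (s := (0, 0, 0, fun _ => 0))
    (body := fun i (s : ℝ × ℝ × ℝ × (ℕ → ℝ)) => do
      let a ← rd p i
      let sp ← addR s.1 a
      let b ← rd q i
      let sq ← addR s.2.1 b
      let mn ← minR sp sq
      let zi ← subR mn s.2.2.1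
      let sz ← addR s.2.2.1 zi
      let z ← wr s.2.2.2 i zi
      return (sp, sq, sz, z))
    (fun j s => s.1 = prefixSum p j ∧ s.2.1 = prefixSum q j ∧
      s.2.2.1 = min (prefixSum p j) (prefixSum q j) ∧
      ∀ i, s.2.2.2 i = if 1 ≤ i ∧ i < j then meet p q i else 0) (by omega)
    ⟨(prefixSum_one p).symm, (prefixSum_one q).symm, by simp [prefixSum_one], fun i => by
      rw [if_neg (by omega)]⟩
    (fun j s hj _ ⟨h1, h2, h3, h4⟩ => by
      simp only [bind_val, rd_val, addR_val, wr_val, pure_val, subR_val, minR_val]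
      refine ⟨by rw [h1, prefixSum_succ p hj], by rw [h2, prefixSum_succ q hj], ?_, fun i => ?_⟩
      · rw [h1, h2, prefixSum_succ p hj, prefixSum_succ q hj]; ring
      · by_cases hij : i = j
        · subst hij
          rw [Function.update_self, if_pos ⟨hj, Nat.lt_succ_self i⟩, h1, h2, h3, meet,
            prefixSum_succ p hj, prefixSum_succ q hj]
        · rw [Function.update_of_ne hij, h4]
          have : (1 ≤ i ∧ i < j + 1) ↔ (1 ≤ i ∧ i < j) := by omega
          simp only [this])
  rw [h.2.2.2 i]
  simp only [Nat.lt_succ_iff]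

/-- The memory with the roles of rows and columns exchanged. -/
def Mem.swap (st : Mem) : Mem := ⟨fun i j => st.M j i, st.C, st.R⟩

theorem update_transpose (M : ℕ → ℕ → ℝ) (i j : ℕ) (x : ℝ) :
    (fun a b => Function.update M i (Function.update (M i) j x) b a) =
      Function.update (fun a b => M b a) j (Function.update (fun b => M b j) i x) := by
  funext a b
  by_cases ha : a = j
  · subst ha
    by_cases hb : b = i
    · subst hb; simp
    · simp [hb]
  · by_cases hb : b = i
    · subst hb; simp [ha]
    · simp [ha, hb]

/-- The treatment of a `q`-segment is that of a `p`-segment for the transposed matrix. -/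
theorem qSegment_val (z p : ℕ → ℝ) (hi lo : ℕ) (st : Mem) :
    (qSegment z p hi lo st).val = (pSegment z p hi lo st.swap).val.swap := by
  unfold qSegment pSegment
  have key : ∀ s : Mem, (forEach (fun j (st : Mem) => do
      let zj ← rd z j
      let pj ← rd p j
      let r ← split zj pj st.C (j + 1) hi
      let st ← forEach (fun l (st : Mem) => do
        let x ← rd st.C l
        let M ← wr2 st.M j l x
        let C ← wr st.C l 0
        return { st with M := M, C := C }) r.2.2 st
      let M ← wr2 st.M j j r.1
      let C ← wr st.C j r.2.1
      return { st with M := M, C := C }) (downTo hi lo) s.swap).val =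
      (forEach (pStep z p hi) (downTo hi lo) s).val.swap := by
    intro s
    refine forEach_rel Mem.swap (fun j s => ?_) _ s
    simp only [pStep, bind_val, pure_val, rd_val, wr_val, wr2_val]
    have inner : ∀ Q : List ℕ, (forEach (fun l (st : Mem) => do
        let x ← rd st.C l
        let M ← wr2 st.M j l x
        let C ← wr st.C l 0
        return { st with M := M, C := C }) Q s.swap).val =
        (forEach (fun l (st : Mem) => do
          let x ← rd st.R l
          let M ← wr2 st.M l j x
          let R ← wr st.R l 0
          return { st with M := M, R := R }) Q s).val.swap := by
      intro Q
      refine forEach_rel Mem.swap (fun l s => ?_) _ s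
      simp only [bind_val, pure_val, rd_val, wr_val, wr2_val, Mem.swap, update_transpose]
    have hC : s.swap.C = s.R := rfl
    rw [hC, inner]
    simp only [Mem.swap, update_transpose]
  have key2 : ∀ s : Mem, (forEach (fun l (st : Mem) => do
        let x ← rd st.C l
        let zero ← eqR x 0
        if zero then
          return st
        else
          let M ← wr2 st.M (lo - 1) l x
          let C ← wr st.C l 0
          return { st with M := M, C := C }) (upTo lo hi) s.swap).val =
      (forEach (pFlush (lo - 1)) (upTo lo hi) s).val.swap := by
    intro s
    refine forEach_rel Mem.swap (fun l s => ?_) _ s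
    have hC : s.swap.C = s.R := rfl
    simp only [pFlush, bind_val, rd_val, eqR_val, hC]
    by_cases h : s.R l = 0
    · simp [h]
    · simp only [h, decide_false, Bool.false_eq_true, if_false, bind_val, pure_val, wr_val, wr2_val,
        Mem.swap, update_transpose]
  have hk := key st.swap
  have hs : st.swap.swap = st := rfl
  rw [hs] at hk
  simp only [bind_val]
  split_ifs
  · exact hk
  · simp only [hk]
    exact key2 _

/-- The invariant of `mainLoop` when the indices from `hi` on are done and a `p`-segment comes
next; before a `q`-segment it holds with the roles of rows and columns exchanged. Row `hi - 1`
holds what the last segment has left over. The case `hi = N + 1` is singled out because the first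
segment is empty if `p` and `q` come in the wrong order. -/
structure MainLoopInv (N : ℕ) (p q : ℕ → ℝ) (φ : ℝ → ℝ) (B : ℕ → ℝ) (hi : ℕ) (st : Mem) : Prop where
  M_nonneg : ∀ i c, 0 ≤ st.M i c
  R_zero : ∀ i, st.R i = 0
  C_zero : ∀ i, st.C i = 0
  col_zero : ∀ i c, c < hi → st.M i c = 0
  row_zero : ∀ i c, i + 1 < hi → st.M i c = 0
  start : hi = N + 1 → ∀ i c, st.M i c = 0
  edge : 2 ≤ hi → ∑ c ∈ Finset.Ico 1 (N + 1), st.M (hi - 1) c = prefixSum p hi - prefixSum q hi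
  row : ∀ i, hi ≤ i → i ≤ N → ∑ c ∈ Finset.Ico 1 (N + 1), st.M i c = p i
  col : ∀ c, hi ≤ c → c ≤ N → ∑ i ∈ Finset.Ico 1 (N + 1), st.M i c = q c
  potential : cellSum N φ st.M ≤ ∑ i ∈ Finset.Ico hi (N + 1), B i
  le : prefixSum q hi ≤ prefixSum p hi

section TwoDistributions

variable {N : ℕ} {p q z : ℕ → ℝ} {φ : ℝ → ℝ} {B : ℕ → ℝ}

theorem mainLoopInv_pSegment {lo hi : ℕ} {st : Mem}
    (hp : IsOrderedArray N p) (hq : IsOrderedArray N q)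
    (hpq : prefixSum p (N + 1) = prefixSum q (N + 1)) (hφ : φ 0 = 0)
    (hz : ∀ i, z i = if 1 ≤ i ∧ i ≤ N then meet p q i else 0)
    (hB : ∀ i, 1 ≤ i → i ≤ N → ∀ x y, 0 ≤ x → 0 ≤ y → x + y = meet p q i → φ x + φ y ≤ B i)
    (h : MainLoopInv N p q φ B hi st) (hlo : 1 ≤ lo) (hle : lo ≤ hi) (hhi : hi ≤ N + 1)
    (hne : lo < hi ∨ hi = N + 1)
    (hcond : ∀ i, lo ≤ i → i < hi → prefixSum p i ≤ prefixSum q i) :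
    MainLoopInv N q p φ B lo (pSegment z q hi lo st).val.swap := by
  have hzm : ∀ i, 1 ≤ i → i ≤ N → z i = meet p q i := fun i h1 h2 => by
    rw [hz, if_pos ⟨h1, h2⟩]
  have hz0 : ∀ i, 0 ≤ z i := fun i => by
    rw [hz]; split_ifs
    · exact meet_nonneg hp hq i
    · exact le_rfl
  have hzsum : ∀ j, lo ≤ j → j < hi → ∑ i ∈ Finset.Ico j hi, z i =
      prefixSum q hi - prefixSum p j := fun j h1 h2 => by
    rw [Finset.sum_congr rfl fun i hi => hzm i (by have := Finset.mem_Ico.1 hi; omega)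
      (by have := Finset.mem_Ico.1 hi; omega), sum_meet p q h2.le, min_eq_right h.le,
      min_eq_left (hcond j h1 h2)]
  have hqsum : ∀ j, lo ≤ j → j ≤ hi → ∑ i ∈ Finset.Ico j hi, q i =
      prefixSum q hi - prefixSum q j := fun j h1 h2 => sum_Ico_eq_prefixSum_sub q (by omega) h2
  have hlole : prefixSum p lo ≤ prefixSum q lo := by
    rcases hle.eq_or_lt with h1 | h1
    · have : lo = N + 1 := by omega
      rw [this, hpq]
    · exact hcond lo le_rfl h1
  have hzq : ∑ i ∈ Finset.Ico lo hi, (z i - q i) = prefixSum q lo - prefixSum p lo := by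
    rw [Finset.sum_sub_distrib]
    rcases hle.eq_or_lt with h1 | h1
    · have : lo = N + 1 := by omega
      subst h1
      simp [this, hpq]
    · rw [hzsum lo le_rfl h1, hqsum lo le_rfl hle]; ring
  obtain ⟨s1, s2, s3, s4, s5, s6, s7, s8, s9⟩ := pSegment_spec (N := N) (lo := lo) (hi := hi)
    (z := z) (q := q) (φ := φ) (B := B) (st := st) hlo hle hhi hz0
    (fun i k h1 h2 h3 => by
      rw [hzm i (by omega) (by omega), hzm k (by omega) (by omega)]
      exact meet_anti hp hq (by omega) h2)
    hq.nonneg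
    (fun j h1 h2 => by
      rw [hzsum j h1 h2, hqsum j h1 h2.le]
      linarith [hcond j h1 h2])
    (fun h1 => by
      have := hzq
      rw [Finset.sum_sub_distrib, h1, prefixSum_one, prefixSum_one] at this
      rw [h1]
      linarith)
    hφ (fun i h1 h2 => by
      rw [hzm i (by omega) (by omega)]
      exact hB i (by omega) (by omega))
    h.M_nonneg h.col_zero h.R_zero
  generalize (pSegment z q hi lo st).val = s at *
  have hrow0 : ∀ i c, i < lo → st.M i c = 0 := fun i c hi' => by
    rcases hne with h1 | h1
    · exact h.row_zero i c (by omega)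
    · exact h.start h1 i c
  refine ⟨fun i c => s1 c i, fun i => by simp only [Mem.swap, s3, h.C_zero], s2,
    fun i c hc => (s7 c i (Or.inl hc)).trans (hrow0 c i hc), fun i c hi' => s4 c i hi',
    fun hlN i c => ?_, fun h2 => ?_, fun c hc hcN => ?_, fun i hi' hiN => ?_, ?_, hlole⟩
  · have hh : hi = N + 1 := by omega
    exact (s7 c i (by omega)).trans (h.start hh c i)
  · exact (s5 (by omega)).trans hzq
  · by_cases hch : c < hi
    · exact s6 c hc hch
    · refine Eq.trans (Finset.sum_congr rfl fun i _ => ?_) (h.col c (by omega) hcN)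
      exact s7 i c (by omega)
  · by_cases hih : i < hi
    · refine (s8 i hi' hih).trans ?_
      rw [hzm i (by omega) hiN]
      unfold meet
      rw [min_eq_left (hcond i hi' hih)]
      have hs := prefixSum_succ p (k := i) (by omega)
      by_cases hi1 : i + 1 = hi
      · subst hi1
        have := h.edge (by omega)
        rw [Nat.add_sub_cancel] at this
        rw [this, min_eq_right h.le]; linarith
      · rw [Finset.sum_eq_zero fun c _ => h.row_zero i c (by omega),
          min_eq_left (hcond (i + 1) (by omega) (by omega))]
        linarith
    · refine Eq.trans (Finset.sum_congr rfl fun c _ => ?_) (h.row i (by omega) hiN)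
      exact s7 i c (by omega)
  · have e : cellSum N φ s.swap.M = cellSum N φ s.M := cellSum_transpose N φ s.M
    rw [e, ← Finset.sum_Ico_consecutive B hle hhi]
    linarith [h.potential]

theorem mainLoop_spec (hp : IsOrderedArray N p) (hq : IsOrderedArray N q)
    (hpq : prefixSum p (N + 1) = prefixSum q (N + 1)) (hφ : φ 0 = 0)
    (hz : ∀ i, z i = if 1 ≤ i ∧ i ≤ N then meet p q i else 0)
    (hB : ∀ i, 1 ≤ i → i ≤ N → ∀ x y, 0 ≤ x → 0 ≤ y → x + y = meet p q i → φ x + φ y ≤ B i)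
    {P Q : ℕ → ℝ} (hP : ∀ i, 1 ≤ i → i ≤ N + 1 → P i = ∑ l ∈ Finset.Ico i (N + 1), p l)
    (hQ : ∀ i, 1 ≤ i → i ≤ N + 1 → Q i = ∑ l ∈ Finset.Ico i (N + 1), q l)
    (k : ℕ) : ∀ (odd : Bool) (hi : ℕ) (st : Mem), k < hi → hi ≤ N + 1 →
      (k + 1 < hi ∨ hi = N + 1) →
      (∀ i, k < i → i < hi →
        if odd then prefixSum p i ≤ prefixSum q i else prefixSum q i ≤ prefixSum p i) →
      (if odd then MainLoopInv N p q φ B hi st else MainLoopInv N q p φ B hi st.swap) →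
      let st' := (mainLoop p q z odd hi (inversionPoints P Q odd k).val st).val
      MainLoopInv N p q φ B 1 st' ∨ MainLoopInv N q p φ B 1 st'.swap := by
  have hz' : ∀ i, z i = if 1 ≤ i ∧ i ≤ N then meet q p i else 0 := fun i => by
    rw [hz, meet_comm]
  have hB' : ∀ i, 1 ≤ i → i ≤ N → ∀ x y, 0 ≤ x → 0 ≤ y → x + y = meet q p i →
      φ x + φ y ≤ B i := fun i => by rw [meet_comm]; exact hB i
  have hPQ : ∀ i, 1 ≤ i → i ≤ N → (P i < Q i ↔ prefixSum q i < prefixSum p i) := by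
    intro i h1 h2
    rw [hP i h1 (by omega), hQ i h1 (by omega), sum_Ico_eq_prefixSum_sub p h1 (by omega),
      sum_Ico_eq_prefixSum_sub q h1 (by omega), hpq]
    constructor <;> intro h <;> linarith
  have hQP : ∀ i, 1 ≤ i → i ≤ N → (Q i < P i ↔ prefixSum p i < prefixSum q i) := by
    intro i h1 h2
    rw [hP i h1 (by omega), hQ i h1 (by omega), sum_Ico_eq_prefixSum_sub p h1 (by omega),
      sum_Ico_eq_prefixSum_sub q h1 (by omega), hpq]
    constructor <;> intro h <;> linarith
  induction k with
  | zero =>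
    intro odd hi st hk hhi hlast hcond hinv
    cases odd
    · simp only [Bool.false_eq_true, if_false] at hcond hinv
      have := mainLoopInv_pSegment hq hp hpq.symm hφ hz' hB' hinv le_rfl hk hhi (by omega)
        (fun i h1 h2 => hcond i h1 h2)
      left
      simpa [inversionPoints, mainLoop, qSegment_val] using this
    · simp only [if_true] at hcond hinv
      have := mainLoopInv_pSegment hp hq hpq hφ hz hB hinv le_rfl hk hhi (by omega)
        (fun i h1 h2 => hcond i h1 h2)
      right
      simpa [inversionPoints, mainLoop] using this
  | succ k ih =>
    intro odd hi st hk hhi hlast hcond hinv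
    cases odd
    · simp only [Bool.false_eq_true, if_false] at hcond hinv
      by_cases hf : Q (k + 1) < P (k + 1)
      · have h1 := mainLoopInv_pSegment hq hp hpq.symm hφ hz' hB' hinv (lo := k + 2) (by omega)
          (by omega) hhi (by omega) (fun i h1 h2 => hcond i (by omega) h2)
        have h2 := ih true (k + 2) (qSegment z p hi (k + 2) st).val (by omega) (by omega)
          (by omega) (fun i h3 h4 => by
            obtain rfl : i = k + 1 := by omega
            simpa using ((hQP _ (by omega) (by omega)).1 hf).le)
          (by simpa [qSegment_val] using h1)
        simpa [inversionPoints, hf, mainLoop] using h2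
      · have h2 := ih false hi st (by omega) hhi (by omega) (fun i h3 h4 => by
            by_cases hi : i = k + 1
            · subst hi
              simpa using not_lt.1 fun h => hf ((hQP _ (by omega) (by omega)).2 h)
            · simpa using hcond i (by omega) h4) (by simpa using hinv)
        simpa [inversionPoints, hf] using h2
    · simp only [if_true] at hcond hinv
      by_cases hf : P (k + 1) < Q (k + 1)
      · have h1 := mainLoopInv_pSegment hp hq hpq hφ hz hB hinv (lo := k + 2) (by omega)
          (by omega) hhi (by omega) (fun i h1 h2 => hcond i (by omega) h2)
        have h2 := ih false (k + 2) (pSegment z q hi (k + 2) st).val (by omega) (by omega)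
          (by omega) (fun i h3 h4 => by
            obtain rfl : i = k + 1 := by omega
            simpa using ((hPQ _ (by omega) (by omega)).1 hf).le)
          (by simpa using h1)
        simpa [inversionPoints, hf, mainLoop] using h2
      · have h2 := ih true hi st (by omega) hhi (by omega) (fun i h3 h4 => by
            by_cases hi : i = k + 1
            · subst hi
              simpa using not_lt.1 fun h => hf ((hPQ _ (by omega) (by omega)).2 h)
            · simpa using hcond i (by omega) h4) (by simpa using hinv)
        simpa [inversionPoints, hf] using h2

theorem orderedMinEntropyJoint_spec (hp : IsOrderedArray N p) (hq : IsOrderedArray N q)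
    (hpq : prefixSum p (N + 1) = prefixSum q (N + 1)) (hφ : φ 0 = 0)
    (hB : ∀ i, 1 ≤ i → i ≤ N → ∀ x y, 0 ≤ x → 0 ≤ y → x + y = meet p q i → φ x + φ y ≤ B i) :
    let M := (orderedMinEntropyJoint N p q).val
    (∀ i c, 0 ≤ M i c) ∧
    (∀ i, 1 ≤ i → i ≤ N → ∑ c ∈ Finset.Ico 1 (N + 1), M i c = p i) ∧
    (∀ c, 1 ≤ c → c ≤ N → ∑ i ∈ Finset.Ico 1 (N + 1), M i c = q c) ∧
    cellSum N φ M ≤ ∑ i ∈ Finset.Ico 1 (N + 1), B i := by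
  have h := mainLoop_spec hp hq hpq hφ (z := (glb N p q).val) (fun i => glb_val p q) hB
    (fun i => suffixSums_val p) (fun i => suffixSums_val q) N true (N + 1)
    ⟨fun _ _ => 0, fun _ => 0, fun _ => 0⟩ (by omega) le_rfl (Or.inr rfl)
    (fun i h1 h2 => by omega)
    (by
      simp only [if_true]
      exact ⟨by simp, by simp, by simp, by simp, by simp, by simp, by simp [hpq],
        fun i _ _ => by omega, fun i _ _ => by omega, by simp [cellSum, hφ], hpq.ge⟩)
  simp only [orderedMinEntropyJoint, bind_val, pure_val, newMatrix_val, newArray_val]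
  generalize (mainLoop p q _ true _ _ _).val = st at h
  rcases h with h | h
  · exact ⟨h.M_nonneg, h.row, h.col, h.potential⟩
  · exact ⟨fun i c => h.M_nonneg c i, h.col, h.row,
      (cellSum_transpose N φ st.M).symm.trans_le h.potential⟩

/-- The matrix computed for `p` and `q` has row sums `p` and column sums `q`, and its non-zero
cells arise by splitting each component of `p ∧ q` into at most two parts. The latter is expressed
through sums of functions `φ` over the cells. -/
theorem minEntropyJoint_spec (hp : IsOrderedArray N p) (hq : IsOrderedArray N q)
    (hpq : prefixSum p (N + 1) = prefixSum q (N + 1)) (hφ : φ 0 = 0)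
    (hB : ∀ i, 1 ≤ i → i ≤ N → ∀ x y, 0 ≤ x → 0 ≤ y → x + y = meet p q i → φ x + φ y ≤ B i) :
    let M := (minEntropyJoint N p q).val
    (∀ i c, 0 ≤ M i c) ∧
    (∀ i, 1 ≤ i → i ≤ N → ∑ c ∈ Finset.Ico 1 (N + 1), M i c = p i) ∧
    (∀ c, 1 ≤ c → c ≤ N → ∑ i ∈ Finset.Ico 1 (N + 1), M i c = q c) ∧
    cellSum N φ M ≤ ∑ i ∈ Finset.Ico 1 (N + 1), B i := by
  by_cases hs : (needsSwap p q N).val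
  · obtain ⟨h1, h2, h3, h4⟩ := orderedMinEntropyJoint_spec hq hp hpq.symm hφ
      (fun i => by rw [meet_comm]; exact hB i)
    have e : (minEntropyJoint N p q).val = fun i c => (orderedMinEntropyJoint N q p).val c i := by
      simp [minEntropyJoint, hs]
    rw [e]
    exact ⟨fun i c => h1 c i, h3, h2, (cellSum_transpose N φ _).trans_le h4⟩
  · have e : (minEntropyJoint N p q).val = (orderedMinEntropyJoint N p q).val := by
      simp [minEntropyJoint, hs]
    rw [e]
    exact orderedMinEntropyJoint_spec hp hq hpq hφ hB

end TwoDistributions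

/-! ### Majorization through truncated sums -/

theorem IsOrderedArray.le_of_le {N : ℕ} {p : ℕ → ℝ} (hp : IsOrderedArray N p) {i k : ℕ}
    (hi : 1 ≤ i) (hk : i ≤ k) : p k ≤ p i := by
  induction k, hk using Nat.le_induction with
  | base => rfl
  | succ k hk ih => exact (hp.anti k (hi.trans hk)).trans ih

/-- Comparison of truncated sums bounds the sum of any `k` components of `y` by the sum of the `k`
largest components of `p`: truncate at the `k`-th component of `p`. -/
theorem sum_le_prefixSum {ι : Type} [Fintype ι] {N : ℕ} {p : ℕ → ℝ} (hp : IsOrderedArray N p)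
    {y : ι → ℝ} (hy : ∀ j, 0 ≤ y j) (htot : ∑ j, y j = prefixSum p (N + 1))
    (h : ∀ t, 0 ≤ t → ∑ i ∈ Finset.Ico 1 (N + 1), min (p i) t ≤ ∑ j, min (y j) t)
    (S : Finset ι) : ∑ j ∈ S, y j ≤ prefixSum p (S.card + 1) := by
  classical
  rcases Nat.eq_zero_or_pos S.card with h0 | h0
  · rw [Finset.card_eq_zero.1 h0]
    simp [prefixSum]
  by_cases hN : N ≤ S.card
  · rw [hp.prefixSum_eq (by omega), ← htot]
    exact Finset.sum_le_sum_of_subset_of_nonneg (Finset.subset_univ S) fun j _ _ => hy j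
  have h1 := h (p S.card) (hp.nonneg _)
  rw [← Finset.sum_Ico_consecutive _ (show 1 ≤ S.card + 1 by omega)
    (show S.card + 1 ≤ N + 1 by omega)] at h1
  have e1 : ∑ i ∈ Finset.Ico 1 (S.card + 1), min (p i) (p S.card) = S.card * p S.card := by
    rw [Finset.sum_congr rfl fun i hi => min_eq_right
      (hp.le_of_le (Finset.mem_Ico.1 hi).1 (Nat.lt_succ_iff.1 (Finset.mem_Ico.1 hi).2))]
    simp
  have e2 : ∑ i ∈ Finset.Ico (S.card + 1) (N + 1), min (p i) (p S.card) =
      prefixSum p (N + 1) - prefixSum p (S.card + 1) := by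
    rw [← sum_Ico_eq_prefixSum_sub p (by omega) (by omega)]
    exact Finset.sum_congr rfl fun i hi => min_eq_left
      (hp.le_of_le h0 (by have := Finset.mem_Ico.1 hi; omega))
  have e3 : ∑ j, min (y j) (p S.card) ≤ S.card * p S.card + ∑ j ∈ Sᶜ, y j := by
    rw [← Finset.sum_add_sum_compl S, ← nsmul_eq_mul]
    exact add_le_add (Finset.sum_le_card_nsmul _ _ _ fun j _ => min_le_right _ _)
      (Finset.sum_le_sum fun j _ => min_le_left _ _)
  have e4 := Finset.sum_add_sum_compl S y
  linarith

/-- `p ∧ q` is the greatest lower bound: what is majorized by `p` and by `q` is majorized by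
`p ∧ q`. At the threshold `t`, the components of `y` above `t` decide. -/
theorem sum_min_meet_le {ι : Type} [Fintype ι] {N : ℕ} {p q : ℕ → ℝ} (hp : IsOrderedArray N p)
    (hq : IsOrderedArray N q) (hpq : prefixSum p (N + 1) = prefixSum q (N + 1)) {y : ι → ℝ}
    (hy : ∀ j, 0 ≤ y j) (htot : ∑ j, y j = prefixSum p (N + 1))
    (h₁ : ∀ t, 0 ≤ t → ∑ i ∈ Finset.Ico 1 (N + 1), min (p i) t ≤ ∑ j, min (y j) t)
    (h₂ : ∀ t, 0 ≤ t → ∑ i ∈ Finset.Ico 1 (N + 1), min (q i) t ≤ ∑ j, min (y j) t)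
    {t : ℝ} (ht : 0 ≤ t) :
    ∑ i ∈ Finset.Ico 1 (N + 1), min (meet p q i) t ≤ ∑ j, min (y j) t := by
  classical
  let S := Finset.univ.filter fun j => t < y j
  have hS : ∑ j, min (y j) t = S.card * t + ∑ j ∈ Sᶜ, y j := by
    rw [← Finset.sum_add_sum_compl S]
    congr 1
    · rw [Finset.sum_congr rfl fun j hj => min_eq_right (Finset.mem_filter.1 hj).2.le]
      simp
    · refine Finset.sum_congr rfl fun j hj => min_eq_left ?_
      simpa [S] using hj
  have hc := Finset.sum_add_sum_compl S y
  by_cases hN : N ≤ S.card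
  · have hle : ∑ i ∈ Finset.Ico 1 (N + 1), min (meet p q i) t ≤ N * t := by
      refine (Finset.sum_le_sum fun i _ => min_le_right _ _).trans ?_
      simp
    have : (N : ℝ) * t ≤ S.card * t := mul_le_mul_of_nonneg_right (by exact_mod_cast hN) ht
    have : 0 ≤ ∑ j ∈ Sᶜ, y j := Finset.sum_nonneg fun j _ => hy j
    linarith
  · rw [← Finset.sum_Ico_consecutive _ (show 1 ≤ S.card + 1 by omega)
      (show S.card + 1 ≤ N + 1 by omega)]
    have e1 : ∑ i ∈ Finset.Ico 1 (S.card + 1), min (meet p q i) t ≤ S.card * t := by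
      refine (Finset.sum_le_sum fun i _ => min_le_right _ _).trans ?_
      simp
    have e2 : ∑ i ∈ Finset.Ico (S.card + 1) (N + 1), min (meet p q i) t ≤
        prefixSum p (N + 1) - min (prefixSum p (S.card + 1)) (prefixSum q (S.card + 1)) := by
      refine (Finset.sum_le_sum fun i _ => min_le_left _ _).trans ?_
      rw [sum_meet p q (by omega), ← hpq, min_self]
    have e3 := le_min (sum_le_prefixSum hp hy htot h₁ S)
      (sum_le_prefixSum hq hy (htot.trans hpq) h₂ S)
    linarith

/-- The previous lemma for `K` copies of `y / K`, the result of splitting every component of `y`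
into `K` equal parts. -/
theorem sum_min_meet_le_mul {ι : Type} [Fintype ι] {N : ℕ} {p q : ℕ → ℝ} (hp : IsOrderedArray N p)
    (hq : IsOrderedArray N q) (hpq : prefixSum p (N + 1) = prefixSum q (N + 1)) {y : ι → ℝ}
    (hy : ∀ j, 0 ≤ y j) (htot : ∑ j, y j = prefixSum p (N + 1)) {K : ℕ} (hK : 0 < K)
    (h₁ : ∀ t, 0 ≤ t → ∑ i ∈ Finset.Ico 1 (N + 1), min (p i) t ≤ ∑ j, min (y j) (K * t))
    (h₂ : ∀ t, 0 ≤ t → ∑ i ∈ Finset.Ico 1 (N + 1), min (q i) t ≤ ∑ j, min (y j) (K * t))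
    {t : ℝ} (ht : 0 ≤ t) :
    ∑ i ∈ Finset.Ico 1 (N + 1), min (meet p q i) t ≤ ∑ j, min (y j) (K * t) := by
  have hK' : (0 : ℝ) < K := by exact_mod_cast hK
  have key : ∀ t : ℝ, ∑ x : Fin K × ι, min ((fun x : Fin K × ι => y x.2 / K) x) t = ∑ j, min (y j) (K * t) := by
    intro t
    rw [Fintype.sum_prod_type]
    simp only [Finset.sum_const, Finset.card_univ, Fintype.card_fin, nsmul_eq_mul, Finset.mul_sum]
    refine Finset.sum_congr rfl fun j _ => ?_
    rw [mul_min_of_nonneg _ _ hK'.le, mul_div_cancel₀ _ hK'.ne']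
  rw [← key]
  refine sum_min_meet_le (y := fun x : Fin K × ι => y x.2 / K) hp hq hpq (fun x => div_nonneg (hy x.2) hK'.le) ?_
    (fun t ht => (h₁ t ht).trans_eq (key t).symm) (fun t ht => (h₂ t ht).trans_eq (key t).symm) ht
  rw [Fintype.sum_prod_type, ← htot]
  simp only [Finset.sum_const, Finset.card_univ, Fintype.card_fin, nsmul_eq_mul, Finset.mul_sum]
  exact Finset.sum_congr rfl fun j _ => mul_div_cancel₀ _ hK'.ne'

theorem min_add_min_le {x y z t : ℝ} (h : x + y = z) : min x t + min y t ≤ min z (2 * t) := by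
  refine le_min ?_ ?_
  · linarith [min_le_left x t, min_le_left y t]
  · linarith [min_le_right x t, min_le_right y t]

theorem min_sum_le {ι : Type} (s : Finset ι) {f : ι → ℝ} (hf : ∀ i ∈ s, 0 ≤ f i) {t : ℝ}
    (ht : 0 ≤ t) : min (∑ i ∈ s, f i) t ≤ ∑ i ∈ s, min (f i) t := by
  classical
  induction s using Finset.induction_on with
  | empty => simp [ht]
  | insert a s ha ih =>
    rw [Finset.sum_insert ha, Finset.sum_insert ha]
    have h1 := ih fun i hi => hf i (Finset.mem_insert_of_mem hi)
    have h2 := hf a (Finset.mem_insert_self a s)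
    have h3 : 0 ≤ ∑ i ∈ s, f i := Finset.sum_nonneg fun i hi => hf i (Finset.mem_insert_of_mem hi)
    rcases min_cases (f a) t with ⟨h, h'⟩ | ⟨h, h'⟩ <;>
      rcases min_cases (∑ i ∈ s, f i) t with ⟨g, g'⟩ | ⟨g, g'⟩ <;>
      rcases min_cases (f a + ∑ i ∈ s, f i) t with ⟨k, k'⟩ | ⟨k, k'⟩ <;> linarith

/-! ### Entropy as an integral of truncated sums -/

open MeasureTheory in
/-- The integral that turns truncated sums into entropies. -/
theorem integral_min_div {x T : ℝ} (hx : 0 ≤ x) (hx1 : x ≤ 1) (hT : 1 ≤ T) :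
    IntervalIntegrable (fun s => min x (T * s) / s) volume 0 1 ∧
      ∫ s in (0 : ℝ)..1, min x (T * s) / s = x + x * Real.log T + Real.negMulLog x := by
  have hT0 : 0 < T := by linarith
  rcases hx.eq_or_lt with rfl | hx
  · have : Set.EqOn (fun _ => (0 : ℝ)) (fun s => min 0 (T * s) / s) (Set.uIoc 0 1) := by
      intro s hs
      rw [Set.uIoc_of_le zero_le_one] at hs
      simp [min_eq_left (mul_pos hT0 hs.1).le]
    refine ⟨(intervalIntegrable_const (c := (0 : ℝ))).congr this, ?_⟩
    rw [intervalIntegral.integral_congr_ae (.of_forall fun s hs => (this hs).symm)]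
    simp
  · set a := x / T with ha
    have ha0 : 0 < a := div_pos hx hT0
    have ha1 : a ≤ 1 := (div_le_one hT0).2 (hx1.trans hT)
    have hTa : T * a = x := by rw [ha]; field_simp
    have e1 : Set.EqOn (fun _ => T) (fun s => min x (T * s) / s) (Set.uIoc 0 a) := by
      intro s hs
      rw [Set.uIoc_of_le ha0.le] at hs
      have : T * s ≤ x := hTa ▸ mul_le_mul_of_nonneg_left hs.2 hT0.le
      simp only [min_eq_right this]
      rw [mul_div_assoc, div_self hs.1.ne', mul_one]
    have e2 : Set.EqOn (fun s => x * s⁻¹) (fun s => min x (T * s) / s) (Set.uIoc a 1) := by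
      intro s hs
      rw [Set.uIoc_of_le ha1] at hs
      have : x ≤ T * s := hTa ▸ mul_le_mul_of_nonneg_left hs.1.le hT0.le
      simp only [min_eq_left this]
      rfl
    have h0 : (0 : ℝ) ∉ Set.uIcc a 1 := by
      rw [Set.uIcc_of_le ha1]
      exact fun h => not_le.2 ha0 h.1
    have i1 : IntervalIntegrable (fun s => min x (T * s) / s) volume 0 a :=
      (intervalIntegrable_const (c := T)).congr e1
    have i2 : IntervalIntegrable (fun s => min x (T * s) / s) volume a 1 :=
      IntervalIntegrable.congr e2
        ((intervalIntegral.intervalIntegrable_inv (fun s hs h => h0 (h ▸ hs))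
          continuousOn_id).const_mul x)
    refine ⟨i1.trans i2, ?_⟩
    rw [← intervalIntegral.integral_add_adjacent_intervals i1 i2,
      
      intervalIntegral.integral_congr_ae (.of_forall fun s hs => (e1 hs).symm),
      intervalIntegral.integral_congr_ae (.of_forall fun s hs => (e2 hs).symm),
      intervalIntegral.integral_const_mul, integral_inv h0, intervalIntegral.integral_const,
      ha, one_div_div, Real.log_div hT0.ne' hx.ne', Real.negMulLog, smul_eq_mul, sub_zero]
    field_simp
    ring

theorem H_eq {ι : Type} [Fintype ι] (M : ι → ℝ) :
    H M = (∑ x, Real.negMulLog (M x)) / Real.log 2 := by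
  simp only [H, Real.logb, Real.negMulLog, Finset.sum_div, ← Finset.sum_neg_distrib]
  exact Finset.sum_congr rfl fun x _ => by ring

/-- If `c` majorizes the vector obtained from `y` by splitting each component into `T` equal parts,
then the entropy of `c` exceeds that of `y` by at most `log₂ T`. -/
theorem H_le_of_sum_min_le {ι κ : Type} [Fintype ι] [Fintype κ] {c : ι → ℝ} {y : κ → ℝ}
    (hc : ∀ i, 0 ≤ c i) (hc1 : ∑ i, c i = 1) (hy : ∀ j, 0 ≤ y j) (hy1 : ∑ j, y j = 1)
    {T : ℝ} (hT : 1 ≤ T)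
    (h : ∀ t, 0 ≤ t → ∑ i, min (c i) t ≤ ∑ j, min (y j) (T * t)) :
    H c ≤ H y + Real.logb 2 T := by
  have hc' : ∀ i, c i ≤ 1 := fun i => hc1 ▸
    Finset.single_le_sum (fun i _ => hc i) (Finset.mem_univ i)
  have hy' : ∀ j, y j ≤ 1 := fun j => hy1 ▸
    Finset.single_le_sum (fun j _ => hy j) (Finset.mem_univ j)
  have ic := fun i => integral_min_div (hc i) (hc' i) le_rfl
  have iy := fun j => integral_min_div (hy j) (hy' j) hT
  have key : ∫ s in (0 : ℝ)..1, ∑ i, min (c i) (1 * s) / s ≤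
      ∫ s in (0 : ℝ)..1, ∑ j, min (y j) (T * s) / s := by
    refine intervalIntegral.integral_mono_on zero_le_one
      (by simpa only [Finset.sum_fn] using IntervalIntegrable.sum Finset.univ fun i _ => (ic i).1)
      (by simpa only [Finset.sum_fn] using IntervalIntegrable.sum Finset.univ fun j _ => (iy j).1)
      fun s hs => ?_
    rw [← Finset.sum_div, ← Finset.sum_div]
    exact div_le_div_of_nonneg_right (by simpa using h s hs.1) hs.1
  rw [intervalIntegral.integral_finsetSum fun i _ => (ic i).1,
    intervalIntegral.integral_finsetSum fun j _ => (iy j).1,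
    Finset.sum_congr rfl fun i _ => (ic i).2, Finset.sum_congr rfl fun j _ => (iy j).2] at key
  simp only [Finset.sum_add_distrib, ← Finset.sum_mul, hc1, hy1, Real.log_one] at key
  rw [H_eq, H_eq, Real.logb, ← add_div]
  exact div_le_div_of_nonneg_right (by linarith) (Real.log_nonneg one_le_two)

/-! ### Joint distributions of minimum entropy -/

theorem IsJoint.sum_eq_one {m n : ℕ} [NeZero m] {p : Fin m → Fin n → ℝ} {M : (Fin m → Fin n) → ℝ}
    (hp : ∀ i, IsOrderedDist (p i)) (h : IsJoint p M) : ∑ x, M x = 1 := by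
  rw [← (hp 0).2.2, ← Finset.sum_congr rfl fun t _ => h.2 0 t]
  exact (Finset.sum_fiberwise _ _ _).symm

/-- The marginals of a joint distribution majorize it, since they aggregate its entries. -/
theorem IsJoint.sum_min_le {m n : ℕ} {p : Fin m → Fin n → ℝ} {M : (Fin m → Fin n) → ℝ}
    (h : IsJoint p M) (i : Fin m) {t : ℝ} (ht : 0 ≤ t) :
    ∑ s, min (p i s) t ≤ ∑ x, min (M x) t := by
  rw [← Finset.sum_fiberwise Finset.univ (fun x : Fin m → Fin n => x i)]
  refine Finset.sum_le_sum fun s _ => ?_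
  rw [← h.2 i s]
  exact min_sum_le _ (fun x _ => h.1 x) ht

theorem exists_isMinEntropyJoint {m n : ℕ} [NeZero m] {p : Fin m → Fin n → ℝ}
    (hp : ∀ i, IsOrderedDist (p i)) {M : (Fin m → Fin n) → ℝ} (hM : IsJoint p M) :
    ∃ Mstar, IsMinEntropyJoint p Mstar := by
  have hcl : IsClosed {N | IsJoint p N} := by
    simp only [IsJoint, Set.ofPred_and, Set.ofPred_forall]
    refine (isClosed_iInter fun x => isClosed_le continuous_const (continuous_apply x)).inter
      (isClosed_iInter fun i => isClosed_iInter fun t => isClosed_eq ?_ continuous_const)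
    exact continuous_finsetSum _ fun x _ => continuous_apply x
  have hcpt : IsCompact {N | IsJoint p N} := by
    refine (isCompact_Icc (a := (0 : (Fin m → Fin n) → ℝ)) (b := 1)).of_isClosed_subset hcl
      fun N hN => ⟨fun x => hN.1 x, fun x => ?_⟩
    exact (Finset.single_le_sum (fun x _ => hN.1 x) (Finset.mem_univ x)).trans_eq (hN.sum_eq_one hp)
  have hcont : Continuous fun N : (Fin m → Fin n) → ℝ => H N := by
    simp only [H_eq]
    exact (continuous_finsetSum _ fun x _ =>
      Real.continuous_negMulLog.comp (continuous_apply x)).div_const _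
  obtain ⟨N, hN, hmin⟩ := hcpt.exists_isMinOn ⟨M, hM⟩ hcont.continuousOn
  exact ⟨N, hN, fun N' hN' => hmin hN'⟩

/-! ### The vectors at the nodes of the tree -/

section Sorting

variable {n : ℕ}

theorem insertDesc_perm (e : Entry n) (l : List (Entry n)) :
    (insertDesc e l).val.Perm (e :: l) := by
  induction l with
  | nil => exact List.Perm.refl _
  | cons f l ih =>
    by_cases h : e.1 < f.1
    · have : (insertDesc e (f :: l)).val = f :: (insertDesc e l).val := by simp [insertDesc, h]
      rw [this]
      exact (ih.cons f).trans (List.Perm.swap e f l)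
    · have : (insertDesc e (f :: l)).val = e :: f :: l := by simp [insertDesc, h]
      rw [this]

theorem sortDesc_perm (l : List (Entry n)) : (sortDesc l).val.Perm l := by
  induction l with
  | nil => exact List.Perm.refl _
  | cons e l ih =>
    have : (sortDesc (e :: l)).val = (insertDesc e (sortDesc l).val).val := by simp [sortDesc]
    rw [this]
    exact (insertDesc_perm _ _).trans (ih.cons e)

theorem insertDesc_sorted (e : Entry n) {l : List (Entry n)}
    (hl : l.Pairwise fun e f => f.1 ≤ e.1) :
    (insertDesc e l).val.Pairwise fun e f => f.1 ≤ e.1 := by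
  induction l with
  | nil => exact List.pairwise_singleton _ _
  | cons f l ih =>
    obtain ⟨h1, h2⟩ := List.pairwise_cons.1 hl
    by_cases h : e.1 < f.1
    · have : (insertDesc e (f :: l)).val = f :: (insertDesc e l).val := by simp [insertDesc, h]
      rw [this, List.pairwise_cons]
      refine ⟨fun g hg => ?_, ih h2⟩
      rcases List.mem_cons.1 ((insertDesc_perm e l).mem_iff.1 hg) with rfl | hg
      · exact h.le
      · exact h1 g hg
    · have : (insertDesc e (f :: l)).val = e :: f :: l := by simp [insertDesc, h]
      rw [this, List.pairwise_cons]
      refine ⟨fun g hg => ?_, hl⟩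
      have h' := not_lt.1 h
      rcases List.mem_cons.1 hg with rfl | hg
      · exact h'
      · exact (h1 g hg).trans h'

theorem sortDesc_sorted (l : List (Entry n)) :
    (sortDesc l).val.Pairwise fun e f => f.1 ≤ e.1 := by
  induction l with
  | nil => exact List.Pairwise.nil
  | cons e l ih =>
    have : (sortDesc (e :: l)).val = (insertDesc e (sortDesc l).val).val := by simp [sortDesc]
    rw [this]
    exact insertDesc_sorted e ih

theorem sum_map_sortDesc (l : List (Entry n)) (F : Entry n → ℝ) :
    ((sortDesc l).val.map F).sum = (l.map F).sum := ((sortDesc_perm l).map F).sum_eq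

end Sorting

section Loading

variable {n : ℕ} {N : ℕ} {l : List (Entry n)}

theorem load_val_add_one (N : ℕ) (l : List (Entry n)) (i : ℕ) :
    (load N l).val (i + 1) = (l.map Prod.fst).getD i 0 := rfl

theorem load_val_getElem (N : ℕ) (l : List (Entry n)) (i : Fin l.length) :
    (load N l).val (i + 1) = l[i.1].1 := by
  rw [load_val_add_one, List.getD_eq_getElem _ _ (by simp)]
  simp

theorem load_val_of_length_lt (N : ℕ) {i : ℕ} (h : l.length < i) : (load N l).val i = 0 := by
  obtain ⟨i, rfl⟩ : ∃ k, i = k + 1 := ⟨i - 1, by omega⟩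
  rw [load_val_add_one, List.getD_eq_default _ _ (by simpa using Nat.lt_succ_iff.1 h)]

theorem isOrderedArray_load (h0 : ∀ e ∈ l, 0 ≤ e.1) (hs : l.Pairwise fun e f => f.1 ≤ e.1)
    (hN : l.length ≤ N) : IsOrderedArray N (load N l).val := by
  have hnn : ∀ i, 0 ≤ (load N l).val i := by
    intro i
    rcases i with _ | i
    · exact le_rfl
    · by_cases hi : i < l.length
      · rw [load_val_getElem N l ⟨i, hi⟩]
        exact h0 _ (List.getElem_mem _)
      · rw [load_val_of_length_lt N (by omega)]
  refine ⟨hnn, fun i hi => ?_, fun i hi => load_val_of_length_lt N (by omega)⟩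
  by_cases hi' : i < l.length
  · obtain ⟨i, rfl⟩ : ∃ k, i = k + 1 := ⟨i - 1, by omega⟩
    rw [load_val_getElem N l ⟨i + 1, hi'⟩, load_val_getElem N l ⟨i, by omega⟩]
    exact List.pairwise_iff_getElem.1 hs i (i + 1) _ _ (Nat.lt_succ_self i)
  · rw [load_val_of_length_lt N (by omega)]
    exact hnn i

theorem sum_Ico_eq_sum_fin {L : ℕ} (hL : L ≤ N) {g : ℕ → ℝ} (hg : ∀ i, L < i → i ≤ N → g i = 0) :
    ∑ i ∈ Finset.Ico 1 (N + 1), g i = ∑ k : Fin L, g (k + 1) := by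
  rw [Fin.sum_univ_eq_sum_range (fun k => g (k + 1)), Finset.sum_Ico_eq_sum_range,
    Nat.add_sub_cancel]
  simp only [add_comm 1]
  refine (Finset.sum_subset (Finset.range_subset_range.2 hL) fun i hi hi' => hg _ ?_ ?_).symm
  · rw [Finset.mem_range] at hi'; omega
  · rw [Finset.mem_range] at hi; omega

theorem sum_load (hN : l.length ≤ N) {f : ℝ → ℝ} (hf : f 0 = 0) :
    ∑ i ∈ Finset.Ico 1 (N + 1), f ((load N l).val i) = (l.map fun e => f e.1).sum := by
  rw [sum_Ico_eq_sum_fin hN fun i hi _ => by rw [load_val_of_length_lt N hi, hf],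
    ← Fin.sum_univ_fun_getElem]
  exact Finset.sum_congr rfl fun i _ => by rw [load_val_getElem]

theorem prefixSum_load (hN : l.length ≤ N) :
    prefixSum (load N l).val (N + 1) = (l.map Prod.fst).sum := sum_load hN (f := id) rfl

end Loading

section Collecting

variable {n : ℕ} {M : ℕ → ℕ → ℝ}

theorem sum_collectRow {F : Entry n → ℝ} (hF : ∀ v, F (0, v) = 0) (s : ℕ) (u : List (Fin n))
    (t : ℕ) (l : List (Entry n)) :
    ((collectRow M s u t l).val.map F).sum =
      ∑ k : Fin l.length, F (M s (k + t), u ++ l[k.1].2) := by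
  induction l generalizing t with
  | nil => simp [collectRow]
  | cons f l ih =>
    have e : ∑ k : Fin (f :: l).length, F (M s (k + t), u ++ (f :: l)[k.1].2) =
        F (M s t, u ++ f.2) + ∑ k : Fin l.length, F (M s (k + (t + 1)), u ++ l[k.1].2) := by
      refine (Fin.sum_univ_succ _).trans ?_
      simp [add_assoc, add_comm 1 t]
    rw [e]
    by_cases h : M s t = 0
    · simp [collectRow, h, ih, hF]
    · simp [collectRow, h, ih, concat]

theorem sum_collect {F : Entry n → ℝ} (hF : ∀ v, F (0, v) = 0) (b : List (Entry n)) (s : ℕ)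
    (l : List (Entry n)) :
    ((collect M b s l).val.map F).sum =
      ∑ i : Fin l.length, ∑ k : Fin b.length, F (M (i + s) (k + 1), l[i.1].2 ++ b[k.1].2) := by
  induction l generalizing s with
  | nil => simp [collect]
  | cons e l ih =>
    refine Eq.trans ?_ (Fin.sum_univ_succ _).symm
    simp [collect, ih, sum_collectRow hF, add_assoc, add_comm 1 s]

theorem mem_collectRow {s : ℕ} {u : List (Fin n)} {t : ℕ} {l : List (Entry n)} {e : Entry n}
    (he : e ∈ (collectRow M s u t l).val) :
    e.1 ≠ 0 ∧ ∃ c, e.1 = M s c ∧ ∃ f ∈ l, e.2 = u ++ f.2 := by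
  induction l generalizing t with
  | nil => simp [collectRow] at he
  | cons f l ih =>
    by_cases h : M s t = 0
    · simp only [collectRow, bind_val, rd2_val, eqR_val, h, decide_true, if_true] at he
      obtain ⟨h1, c, h2, g, hg, h3⟩ := ih he
      exact ⟨h1, c, h2, g, by simp [hg], h3⟩
    · simp only [collectRow, bind_val, rd2_val, eqR_val, h, decide_false, Bool.false_eq_true,
        if_false, pure_val, concat, List.mem_cons] at he
      rcases he with rfl | he
      · exact ⟨h, t, rfl, f, by simp, rfl⟩
      · obtain ⟨h1, c, h2, g, hg, h3⟩ := ih he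
        exact ⟨h1, c, h2, g, by simp [hg], h3⟩

theorem mem_collect {b : List (Entry n)} {s : ℕ} {l : List (Entry n)} {e : Entry n}
    (he : e ∈ (collect M b s l).val) :
    e.1 ≠ 0 ∧ ∃ i c, e.1 = M i c ∧ ∃ g ∈ l, ∃ f ∈ b, e.2 = g.2 ++ f.2 := by
  induction l generalizing s with
  | nil => simp [collect] at he
  | cons g l ih =>
    simp only [collect, bind_val, pure_val, List.mem_append] at he
    rcases he with he | he
    · obtain ⟨h1, c, h2, f, hf, h3⟩ := mem_collectRow he
      exact ⟨h1, s, c, h2, g, by simp, f, hf, h3⟩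
    · obtain ⟨h1, i, c, h2, g', hg', h3⟩ := ih he
      exact ⟨h1, i, c, h2, g', by simp [hg'], h3⟩

end Collecting

/-- The vector `c` belongs to a node, `k` levels above the leaves, whose leaves hold the
distributions `D off, …, D (off + 2 ^ k - 1)`. The last field says that `c` majorizes the vector
obtained from `y` by splitting each component into `2 ^ k` equal parts, whenever `y` is majorized
by all distributions. -/
structure IsNode {n : ℕ} (D : ℕ → Fin n → ℝ) (k off : ℕ) (c : List (Entry n)) : Prop where
  nonneg : ∀ e ∈ c, 0 ≤ e.1
  index_length : ∀ e ∈ c, e.2.length = 2 ^ k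
  sorted : c.Pairwise fun e f => f.1 ≤ e.1
  length_le : c.length ≤ 2 ^ k * n
  total : (c.map Prod.fst).sum = 1
  marginal : ∀ j < 2 ^ k, ∀ t, (c.map fun e => if e.2[j]? = some t then e.1 else 0).sum =
    D (off + j) t
  majorizes : ∀ (ι : Type) [Fintype ι] (y : ι → ℝ), (∀ j, 0 ≤ y j) → ∑ j, y j = 1 →
    (∀ i t, 0 ≤ t → ∑ s, min (D i s) t ≤ ∑ j, min (y j) t) →
    ∀ t, 0 ≤ t → (c.map fun e => min e.1 t).sum ≤ ∑ j, min (y j) ((2 ^ k : ℕ) * t)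

section Tree

variable {n : ℕ} {D : ℕ → Fin n → ℝ}

theorem isNode_leaf (hD : ∀ i, IsOrderedDist (D i)) (off : ℕ) :
    IsNode D 0 off (sortDesc (leaf (D off)).val).val := by
  have hmem : ∀ e ∈ (sortDesc (leaf (D off)).val).val, ∃ t, e = (D off t, [t]) := fun e he => by
    have := (sortDesc_perm _).mem_iff.1 he
    simp only [leaf, List.mem_ofFn] at this
    obtain ⟨t, ht⟩ := this
    exact ⟨t, ht.symm⟩
  have hsum : ∀ F : Entry n → ℝ, ((sortDesc (leaf (D off)).val).val.map F).sum =
      ∑ t, F (D off t, [t]) := fun F => by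
    rw [sum_map_sortDesc]
    simp [leaf, List.sum_ofFn, Function.comp_def]
  refine ⟨fun e he => ?_, fun e he => ?_, sortDesc_sorted _, ?_, ?_, fun j hj t => ?_,
    fun ι _ y _ _ hy t ht => ?_⟩
  · obtain ⟨t, rfl⟩ := hmem e he
    exact (hD off).1 t
  · obtain ⟨t, rfl⟩ := hmem e he
    simp
  · rw [(sortDesc_perm _).length_eq]
    simp [leaf]
  · rw [hsum]
    exact (hD off).2.2
  · rw [hsum]
    obtain rfl : j = 0 := by simpa using hj
    simp
  · rw [hsum]
    simpa using hy off t ht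

theorem isNode_mergeNode {k off : ℕ} {a b : List (Entry n)} (ha : IsNode D k off a)
    (hb : IsNode D k (off + 2 ^ k) b) : IsNode D (k + 1) off (mergeNode a b).val := by
  set N := max a.length b.length with hN
  have hNa : a.length ≤ N := le_max_left _ _
  have hNb : b.length ≤ N := le_max_right _ _
  set p := (load N a).val with hp_def
  set q := (load N b).val with hq_def
  have hp : IsOrderedArray N p := isOrderedArray_load ha.nonneg ha.sorted hNa
  have hq : IsOrderedArray N q := isOrderedArray_load hb.nonneg hb.sorted hNb
  have hp1 : prefixSum p (N + 1) = 1 := (prefixSum_load hNa).trans ha.total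
  have hq1 : prefixSum q (N + 1) = 1 := (prefixSum_load hNb).trans hb.total
  have spec := fun (φ : ℝ → ℝ) (hφ : φ 0 = 0) (B : ℕ → ℝ) => minEntropyJoint_spec (B := B) hp hq
    (hp1.trans hq1.symm) hφ
  set M := (minEntropyJoint N p q).val with hM_def
  obtain ⟨hM, hrow, hcol, -⟩ := spec (fun _ => 0) rfl (fun _ => 0) (by simp)
  -- The padding contributes nothing: its cells lie in rows or columns with sum zero.
  have hrow0 : ∀ i, a.length < i → i ≤ N → ∀ c, 1 ≤ c → c ≤ N → M i c = 0 := by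
    intro i h1 h2 c h3 h4
    have := hrow i (by omega) h2
    rw [hp_def, load_val_of_length_lt N h1] at this
    exact (Finset.sum_eq_zero_iff_of_nonneg fun c _ => hM i c).1 this c
      (Finset.mem_Ico.2 ⟨h3, by omega⟩)
  have hcol0 : ∀ c, b.length < c → c ≤ N → ∀ i, 1 ≤ i → i ≤ N → M i c = 0 := by
    intro c h1 h2 i h3 h4
    have := hcol c (by omega) h2
    rw [hq_def, load_val_of_length_lt N h1] at this
    exact (Finset.sum_eq_zero_iff_of_nonneg fun i _ => hM i c).1 this i
      (Finset.mem_Ico.2 ⟨h3, by omega⟩)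
  have hrowFin : ∀ i : Fin a.length, ∑ c : Fin b.length, M (i + 1) (c + 1) = a[i.1].1 := by
    intro i
    have hi := i.2
    rw [← sum_Ico_eq_sum_fin (g := fun c => M (i + 1) c) hNb fun c h1 h2 =>
      hcol0 c h1 h2 _ (by omega) (by omega), hrow _ (by omega) (by omega), hp_def,
      load_val_getElem]
  have hcolFin : ∀ c : Fin b.length, ∑ i : Fin a.length, M (i + 1) (c + 1) = b[c.1].1 := by
    intro c
    have hc := c.2
    rw [← sum_Ico_eq_sum_fin (g := fun i => M i (c + 1)) hNa fun i h1 h2 =>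
      hrow0 i h1 h2 _ (by omega) (by omega), hcol _ (by omega) (by omega), hq_def,
      load_val_getElem]
  have hcell : ∀ φ : ℝ → ℝ, φ 0 = 0 →
      ∑ i : Fin a.length, ∑ c : Fin b.length, φ (M (i + 1) (c + 1)) = cellSum N φ M := by
    intro φ hφ
    rw [cellSum, sum_Ico_eq_sum_fin hNa fun i h1 h2 => Finset.sum_eq_zero fun c hc => by
      rw [hrow0 i h1 h2 c (Finset.mem_Ico.1 hc).1 (by have := Finset.mem_Ico.1 hc; omega), hφ]]
    refine Finset.sum_congr rfl fun i _ => ?_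
    rw [sum_Ico_eq_sum_fin hNb fun c h1 h2 => by
      rw [hcol0 c h1 h2 _ (by omega) (by have := i.2; omega), hφ]]
  have hval : (mergeNode a b).val = (sortDesc (collect M b 1 a).val).val := rfl
  have hmem : ∀ e ∈ (mergeNode a b).val,
      e.1 ≠ 0 ∧ ∃ i c, e.1 = M i c ∧ ∃ g ∈ a, ∃ f ∈ b, e.2 = g.2 ++ f.2 := fun e he =>
    mem_collect ((sortDesc_perm _).mem_iff.1 (hval ▸ he))
  have hsum : ∀ F : Entry n → ℝ, (∀ v, F (0, v) = 0) → ((mergeNode a b).val.map F).sum =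
      ∑ i : Fin a.length, ∑ c : Fin b.length, F (M (i + 1) (c + 1), a[i.1].2 ++ b[c.1].2) :=
    fun F hF => by rw [hval, sum_map_sortDesc, sum_collect hF]
  refine ⟨fun e he => ?_, fun e he => ?_, hval ▸ sortDesc_sorted _, ?_, ?_, fun j hj t => ?_,
    fun ι _ y hy0 hy1 hy t ht => ?_⟩
  · obtain ⟨-, i, c, h, -⟩ := hmem e he
    exact h ▸ hM i c
  · obtain ⟨-, -, -, -, g, hg, f, hf, h⟩ := hmem e he
    rw [h, List.length_append, ha.index_length g hg, hb.index_length f hf, pow_succ]; ring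
  · -- Each of the `N` components of `p ∧ q` is split into at most two non-zero parts.
    have h := hsum (fun e => if e.1 = 0 then 0 else 1) (by simp)
    rw [hcell (fun x => if x = 0 then 0 else 1) (by simp)] at h
    have h2 := (spec (fun x => if x = 0 then 0 else 1) (by simp) (fun _ => 2)
      (fun i _ _ x y _ _ _ => by split_ifs <;> norm_num)).2.2.2
    have h3 : ((mergeNode a b).val.map fun e => if e.1 = 0 then (0 : ℝ) else 1).sum =
        (mergeNode a b).val.length := by
      rw [List.map_congr_left fun e he => if_neg (hmem e he).1]
      simp
    rw [← h, h3] at h2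
    have h4 : (mergeNode a b).val.length ≤ N * 2 := by
      simp only [Finset.sum_const, Nat.card_Ico, Nat.add_sub_cancel, nsmul_eq_mul] at h2
      exact_mod_cast h2
    have h5 : N ≤ 2 ^ k * n := max_le ha.length_le hb.length_le
    rw [pow_succ]
    linarith
  · rw [hsum _ (fun _ => rfl), ← ha.total, ← Fin.sum_univ_fun_getElem]
    exact Finset.sum_congr rfl fun i _ => hrowFin i
  · rw [hsum _ (by simp)]
    by_cases hjk : j < 2 ^ k
    · rw [← ha.marginal j hjk t, ← Fin.sum_univ_fun_getElem]
      refine Finset.sum_congr rfl fun i _ => ?_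
      rw [← hrowFin i]
      have hl := ha.index_length _ (List.getElem_mem i.2)
      simp only [List.getElem?_append_left (hl ▸ hjk)]
      split_ifs <;> simp
    · have hb' := hb.marginal (j - 2 ^ k) (by rw [pow_succ] at hj; omega) t
      rw [show off + 2 ^ k + (j - 2 ^ k) = off + j by omega] at hb'
      rw [← hb', ← Fin.sum_univ_fun_getElem, Finset.sum_comm]
      refine Finset.sum_congr rfl fun c _ => ?_
      rw [← hcolFin c]
      have hl : ∀ i : Fin a.length, (a[i.1].2 ++ b[c.1].2)[j]? = b[c.1].2[j - 2 ^ k]? := fun i => by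
        have hl := ha.index_length _ (List.getElem_mem i.2)
        rw [List.getElem?_append_right (by omega), hl]
      simp only [hl]
      split_ifs <;> simp
  · rw [hsum _ (fun _ => min_eq_left ht), hcell (fun x => min x t) (min_eq_left ht)]
    refine (spec (fun x => min x t) (min_eq_left ht) (fun i => min (meet p q i) (2 * t))
      fun i _ _ x y _ _ h => min_add_min_le h).2.2.2.trans ?_
    have h2 : (((2 ^ (k + 1) : ℕ) : ℝ)) * t = (2 ^ k : ℕ) * (2 * t) := by push_cast; ring
    rw [h2]
    refine sum_min_meet_le_mul hp hq (hp1.trans hq1.symm) hy0 (hy1.trans hp1.symm) (by positivity)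
      (fun s hs => ?_) (fun s hs => ?_) (by linarith)
    · rw [sum_load hNa (f := fun x => min x s) (min_eq_left hs)]
      exact ha.majorizes ι y hy0 hy1 hy s hs
    · rw [sum_load hNb (f := fun x => min x s) (min_eq_left hs)]
      exact hb.majorizes ι y hy0 hy1 hy s hs

/-- The vectors in the list belong to adjacent nodes of level `k`, the leaves of which start with
number `off`. -/
def IsLevel (D : ℕ → Fin n → ℝ) (k : ℕ) : ℕ → List (List (Entry n)) → Prop
  | _, [] => True
  | off, a :: l => IsNode D k off a ∧ IsLevel D k (off + 2 ^ k) l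

theorem isLevel_mergeLevel {k : ℕ} (r : ℕ) : ∀ {off : ℕ} {l : List (List (Entry n))},
    l.length = 2 * r → IsLevel D k off l →
    IsLevel D (k + 1) off (mergeLevel l).val ∧ (mergeLevel l).val.length = r := by
  induction r with
  | zero =>
    intro off l hl _
    obtain rfl := List.length_eq_zero_iff.1 hl
    exact ⟨trivial, rfl⟩
  | succ r ih =>
    intro off l hl h
    match l, hl, h with
    | a :: b :: l, hl, h =>
      obtain ⟨h1, h2⟩ := ih (by simpa [mul_add] using hl) h.2.2
      refine ⟨⟨isNode_mergeNode h.1 h.2.1, ?_⟩, congrArg (· + 1) h2⟩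
      rwa [show off + 2 ^ (k + 1) = off + 2 ^ k + 2 ^ k by rw [pow_succ]; ring]
    | [a], hl, _ => simp at hl; omega

theorem isLevel_mergeLevels (r : ℕ) : ∀ {k off : ℕ} {l : List (List (Entry n))},
    l.length = 2 ^ r → IsLevel D k off l →
    IsNode D (k + r) off ((mergeLevels r l).val.headD []) := by
  induction r with
  | zero =>
    intro k off l hl h
    match l, hl, h with
    | [a], _, h => exact h.1
  | succ r ih =>
    intro k off l hl h
    obtain ⟨h1, h2⟩ := isLevel_mergeLevel (2 ^ r) (by rw [hl, pow_succ, mul_comm]) h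
    have := ih h2 h1
    rwa [show k + (r + 1) = k + 1 + r by ring]

theorem isLevel_leaves (hD : ∀ i, IsOrderedDist (D i)) (L : ℕ) (off : ℕ) :
    IsLevel D 0 off (leaves (List.ofFn fun i : Fin L => D (off + i))).val ∧
      (leaves (List.ofFn fun i : Fin L => D (off + i))).val.length = L := by
  induction L generalizing off with
  | zero => exact ⟨trivial, rfl⟩
  | succ L ih =>
    rw [List.ofFn_succ]
    have e : (fun i : Fin L => D (off + i.succ)) = fun i : Fin L => D (off + 1 + i) := by
      funext i
      rw [Fin.val_succ, add_assoc, add_comm 1]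
    obtain ⟨h1, h2⟩ := ih (off + 1)
    rw [← e] at h1 h2
    exact ⟨⟨isNode_leaf hD off, h1⟩, congrArg (· + 1) h2⟩

end Tree

/-- The list of entries at the root of the tree, before coordinates are dropped. -/
noncomputable def rootEntries {m n : ℕ} [NeZero m] (p : Fin m → Fin n → ℝ) : List (Entry n) :=
  (mergeLevels (Nat.clog 2 m)
    (leaves (List.ofFn fun i : Fin (2 ^ Nat.clog 2 m) => p (Fin.ofNat m i))).val).val.headD []

theorem isNode_rootEntries {m n : ℕ} [NeZero m] {p : Fin m → Fin n → ℝ}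
    (hp : ∀ i, IsOrderedDist (p i)) :
    IsNode (fun i => p (Fin.ofNat m i)) (Nat.clog 2 m) 0 (rootEntries p) := by
  have h := isLevel_leaves (D := fun i => p (Fin.ofNat m i)) (fun i => hp _) (2 ^ Nat.clog 2 m) 0
  simp only [zero_add] at h
  have := isLevel_mergeLevels _ h.2 h.1
  rwa [zero_add] at this

/-! ### The output array -/

theorem truncate_val {n : ℕ} (m : ℕ) (l : List (Entry n)) :
    (truncate m l).val = l.map fun e => (e.1, e.2.take m) := by
  induction l with
  | nil => rfl
  | cons e l ih => simp [truncate, ih]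

theorem writeEntries_val {m n : ℕ} (l : List (Entry n)) (M : (Fin m → Fin n) → ℝ)
    (x : Fin m → Fin n) :
    (writeEntries l M).val x = M x + (l.map fun e => if List.ofFn x = e.2 then e.1 else 0).sum := by
  induction l generalizing M with
  | nil => simp [writeEntries]
  | cons e l ih =>
    simp only [writeEntries, bind_val, ih, List.map_cons, List.sum_cons]
    split_ifs <;> ring

section Output

variable {m n : ℕ} [NeZero m] {p : Fin m → Fin n → ℝ}

theorem kMinEntropyJoint_val (p : Fin m → Fin n → ℝ) (x : Fin m → Fin n) :
    (kMinEntropyJoint p).val x =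
      ((rootEntries p).map fun e => if List.ofFn x = e.2.take m then e.1 else 0).sum := by
  have h : (kMinEntropyEntries p).val = (truncate m (rootEntries p)).val := rfl
  simp only [kMinEntropyJoint, bind_val, h, writeEntries_val, truncate_val, List.map_map, zero_add]
  rfl

/-- Exactly one cell receives the entry `e`. -/
theorem exists_index (hp : ∀ i, IsOrderedDist (p i)) {e : Entry n} (he : e ∈ rootEntries p) :
    ∃ x : Fin m → Fin n, (∀ y, List.ofFn y = e.2.take m ↔ y = x) ∧
      ∀ i t, x i = t ↔ e.2[i.1]? = some t := by
  have hlen : m ≤ e.2.length := by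
    rw [(isNode_rootEntries hp).index_length e he]
    exact Nat.le_pow_clog one_lt_two m
  have hx : List.ofFn (fun i : Fin m => e.2[i.1]'(i.2.trans_le hlen)) = e.2.take m := by
    apply List.ext_getElem
    · simp [hlen]
    · intro i h1 h2
      simp
  refine ⟨fun i => e.2[i.1]'(i.2.trans_le hlen), fun y => ?_, fun i t => ?_⟩
  · rw [← hx, List.ofFn_inj]
  · rw [List.getElem?_eq_getElem (i.2.trans_le hlen), Option.some_inj]

theorem kMinEntropyJoint_isJoint (hp : ∀ i, IsOrderedDist (p i)) :
    IsJoint p (kMinEntropyJoint p).val := by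
  have hnode := isNode_rootEntries hp
  refine ⟨fun x => ?_, fun i t => ?_⟩
  · rw [kMinEntropyJoint_val]
    refine List.sum_nonneg fun y hy => ?_
    obtain ⟨e, he, rfl⟩ := List.mem_map.1 hy
    split_ifs
    · exact hnode.nonneg e he
    · exact le_rfl
  · have h := hnode.marginal i (i.2.trans_le (Nat.le_pow_clog one_lt_two m)) t
    have e1 : Fin.ofNat m (0 + i.1) = i := by
      rw [zero_add]
      exact Fin.ofNat_val_eq_self i
    rw [e1] at h
    rw [← h]
    simp only [kMinEntropyJoint_val, ← Fin.sum_univ_fun_getElem]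
    rw [Finset.sum_comm]
    refine Finset.sum_congr rfl fun k _ => ?_
    obtain ⟨x, hx, hx'⟩ := exists_index hp (List.getElem_mem k.2)
    simp only [hx, ← hx', Finset.sum_ite_eq', Finset.mem_filter, Finset.mem_univ, true_and]

/-- Aggregating the entries that share a cell decreases truncated sums. -/
theorem sum_min_kMinEntropyJoint_le (hp : ∀ i, IsOrderedDist (p i)) {t : ℝ} (ht : 0 ≤ t) :
    ∑ x, min ((kMinEntropyJoint p).val x) t ≤ ((rootEntries p).map fun e => min e.1 t).sum := by
  have hnode := isNode_rootEntries hp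
  simp only [kMinEntropyJoint_val, ← Fin.sum_univ_fun_getElem]
  calc _ ≤ ∑ x : Fin m → Fin n, ∑ k : Fin (rootEntries p).length,
        min (if List.ofFn x = (rootEntries p)[k.1].2.take m then (rootEntries p)[k.1].1 else 0) t :=
        Finset.sum_le_sum fun x _ => min_sum_le _ (fun k _ => by
          split_ifs
          · exact hnode.nonneg _ (List.getElem_mem k.2)
          · exact le_rfl) ht
    _ = _ := by
        rw [Finset.sum_comm]
        refine Finset.sum_congr rfl fun k _ => ?_
        obtain ⟨x, hx, -⟩ := exists_index hp (List.getElem_mem k.2)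
        simp only [hx]
        rw [Finset.sum_eq_single x]
        · simp
        · intro y _ hy; simp [hy, ht]
        · simp

/-- The root majorizes the result of splitting each entry of any joint distribution into
`2 ^ ⌈log m⌉` equal parts, and this splitting adds `⌈log m⌉` to the entropy. -/
theorem H_kMinEntropyJoint_le (hp : ∀ i, IsOrderedDist (p i)) {N : (Fin m → Fin n) → ℝ}
    (hN : IsJoint p N) :
    H (kMinEntropyJoint p).val ≤ H N + (⌈Real.logb 2 (m : ℝ)⌉ : ℝ) := by
  have hM := kMinEntropyJoint_isJoint hp
  have h := H_le_of_sum_min_le hM.1 (hM.sum_eq_one hp) hN.1 (hN.sum_eq_one hp)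
    (T := (2 ^ Nat.clog 2 m : ℕ)) (by exact_mod_cast Nat.one_le_two_pow) fun t ht =>
    (sum_min_kMinEntropyJoint_le hp ht).trans ((isNode_rootEntries hp).majorizes _ N hN.1
      (hN.sum_eq_one hp) (fun i s hs => hN.sum_min_le _ hs) t ht)
  have e1 : ⌈Real.logb 2 (m : ℝ)⌉ = (Nat.clog 2 m : ℤ) := by
    have := Real.ceil_logb_natCast (b := 2) (r := (m : ℝ)) (Nat.cast_nonneg m)
    rw [Int.clog_natCast] at this
    exact_mod_cast this
  have e2 : Real.logb 2 ((2 ^ Nat.clog 2 m : ℕ) : ℝ) = Nat.clog 2 m := by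
    push_cast
    rw [Real.logb_pow, Real.logb_self_eq_one one_lt_two, mul_one]
  rw [e2] at h
  rw [e1]
  exact_mod_cast h

end Output

/-! ### Running time for two distributions -/

section StepsTwo

variable {N S : ℕ}

theorem needsSwap_steps_le (p q : ℕ → ℝ) (i : ℕ) : (needsSwap p q i).steps ≤ 5 * i + 1 := by
  induction i with
  | zero => simp [needsSwap]
  | succ i ih =>
    by_cases h : p (i + 1) = q (i + 1)
    · simp [needsSwap, h]; omega
    · simp [needsSwap, h]; omega

theorem suffixSums_steps_le (N : ℕ) (p : ℕ → ℝ) : (suffixSums N p).steps ≤ 6 * N + 2 := by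
  have := forEach_steps_le (B := 4) (body := fun i S => do
    let a ← rd p i
    let b ← rd S (i + 1)
    let c ← addR a b
    wr S i c) (downTo (N + 1) 1) (fun i _ s => by simp) fun _ => 0
  simp only [suffixSums, bind_steps, newArray_steps, newArray_val]
  rw [length_downTo] at this
  omega

theorem glb_steps_le (N : ℕ) (p q : ℕ → ℝ) : (glb N p q).steps ≤ 10 * N + 1 := by
  have := forEach_steps_le (B := 8) (body := fun i (s : ℝ × ℝ × ℝ × (ℕ → ℝ)) => do
      let a ← rd p i
      let sp ← addR s.1 a
      let b ← rd q i
      let sq ← addR s.2.1 b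
      let mn ← minR sp sq
      let zi ← subR mn s.2.2.1
      let sz ← addR s.2.2.1 zi
      let z ← wr s.2.2.2 i zi
      return (sp, sq, sz, z)) (upTo 1 (N + 1)) (fun i _ s => by simp) (0, 0, 0, fun _ => 0)
  simp only [glb, bind_steps, newArray_steps, newArray_val, pure_steps]
  rw [length_upTo] at this
  omega

theorem inversionPoints_steps_le (P Q : ℕ → ℝ) (odd : Bool) (k : ℕ) :
    (inversionPoints P Q odd k).steps ≤ 4 * k + 1 := by
  induction k generalizing odd with
  | zero => simp [inversionPoints]
  | succ k ih =>
    have h1 := ih true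
    have h2 := ih false
    cases odd
    · by_cases h : Q (k + 1) < P (k + 1) <;> simp [inversionPoints, h] <;> omega
    · by_cases h : P (k + 1) < Q (k + 1) <;> simp [inversionPoints, h] <;> omega

theorem inversionPoints_val_le (P Q : ℕ → ℝ) (odd : Bool) (k : ℕ) :
    (inversionPoints P Q odd k).val.length ≤ k + 1 ∧
      ∀ i ∈ (inversionPoints P Q odd k).val, i ≤ k + 1 := by
  have cons : ∀ {l : List ℕ} {k : ℕ}, (l.length ≤ k + 1 ∧ ∀ i ∈ l, i ≤ k + 1) →
      ((k + 2) :: l).length ≤ k + 1 + 1 ∧ ∀ i ∈ (k + 2) :: l, i ≤ k + 1 + 1 := by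
    rintro l k ⟨h1, h2⟩
    refine ⟨by simpa using h1, fun i hi => ?_⟩
    rcases List.mem_cons.1 hi with rfl | hi
    · exact le_rfl
    · exact (h2 i hi).trans (Nat.le_succ _)
  have keep : ∀ {l : List ℕ} {k : ℕ}, (l.length ≤ k + 1 ∧ ∀ i ∈ l, i ≤ k + 1) →
      l.length ≤ k + 1 + 1 ∧ ∀ i ∈ l, i ≤ k + 1 + 1 :=
    fun h => ⟨h.1.trans (Nat.le_succ _), fun i hi => (h.2 i hi).trans (Nat.le_succ _)⟩
  induction k generalizing odd with
  | zero => simp [inversionPoints]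
  | succ k ih =>
    cases odd
    · by_cases h : Q (k + 1) < P (k + 1)
      · have e : (inversionPoints P Q false (k + 1)).val =
            (k + 2) :: (inversionPoints P Q true k).val := by simp [inversionPoints, h]
        rw [e]
        exact cons (ih true)
      · have e : (inversionPoints P Q false (k + 1)).val = (inversionPoints P Q false k).val := by
          simp [inversionPoints, h]
        rw [e]
        exact keep (ih false)
    · by_cases h : P (k + 1) < Q (k + 1)
      · have e : (inversionPoints P Q true (k + 1)).val =
            (k + 2) :: (inversionPoints P Q false k).val := by simp [inversionPoints, h]
        rw [e]
        exact cons (ih false)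
      · have e : (inversionPoints P Q true (k + 1)).val = (inversionPoints P Q true k).val := by
          simp [inversionPoints, h]
        rw [e]
        exact keep (ih true)

theorem split_steps_le (z x : ℝ) (A : ℕ → ℝ) {lo hi : ℕ} (hS : hi ≤ S) :
    (split z x A lo hi).steps ≤ 4 * S + 3 ∧ (split z x A lo hi).val.2.2.length ≤ S := by
  have h1 := scan_steps_le A x (upTo lo hi) 0
  have h2 := length_scan_le A x (upTo lo hi) 0
  rw [length_upTo] at h1 h2
  constructor
  · simp only [split, bind_steps, subR_steps, pure_steps]; omega
  · simp only [split, bind_val, pure_val]; omega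

theorem pSegment_steps_le (z q : ℕ → ℝ) {hi lo : ℕ} (hS : hi ≤ S) (hS1 : 1 ≤ S) (st : Mem) :
    (pSegment z q hi lo st).steps ≤ 25 * S ^ 2 := by
  have hstep : ∀ (j : ℕ) (s : Mem), (pStep z q hi j s).steps ≤ 8 * S + 8 := by
    intro j s
    obtain ⟨h1, h2⟩ := split_steps_le (z j) (q j) s.R (lo := j + 1) hS
    have h3 := forEach_steps_le (B := 3) (body := fun l (st : Mem) => do
      let x ← rd st.R l
      let M ← wr2 st.M l j x
      let R ← wr st.R l 0
      return { st with M := M, R := R }) (split (z j) (q j) s.R (j + 1) hi).val.2.2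
      (fun i _ s => by simp) s
    simp only [pStep, bind_steps, rd_steps, rd_val, wr2_steps, wr_steps, pure_steps]
    omega
  have h1 := forEach_steps_le (downTo hi lo) (fun j _ => hstep j) st
  have h2 := fun st => forEach_steps_le (B := 4) (body := pFlush (lo - 1)) (upTo lo hi)
    (fun l _ s => by by_cases h : s.R l = 0 <;> simp [pFlush, h]) st
  rw [length_downTo] at h1
  simp only [length_upTo] at h2
  have h3 : (hi - lo) * (8 * S + 8 + 1) ≤ S * (8 * S + 8 + 1) := Nat.mul_le_mul_right _ (by omega)
  have e : (pSegment z q hi lo st).steps = (forEach (pStep z q hi) (downTo hi lo) st).steps + (1 +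
      if lo = 1 then 0 else (forEach (pFlush (lo - 1)) (upTo lo hi)
        (forEach (pStep z q hi) (downTo hi lo) st).val).steps) := by
    unfold pSegment
    simp only [bind_steps, tick_steps]
    split_ifs <;> rfl
  have h4 := h2 (forEach (pStep z q hi) (downTo hi lo) st).val
  rw [e]
  have h5 : S ≤ S ^ 2 := Nat.le_self_pow two_ne_zero S
  have h6 : S * (8 * S + 8 + 1) = 8 * S ^ 2 + 9 * S := by ring
  split_ifs <;> omega

theorem qSegment_steps_le (z p : ℕ → ℝ) {hi lo : ℕ} (hS : hi ≤ S) (hS1 : 1 ≤ S) (st : Mem) :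
    (qSegment z p hi lo st).steps ≤ 25 * S ^ 2 := by
  have h1 := forEach_steps_le (B := 8 * S + 8) (body := fun j (st : Mem) => do
    let zj ← rd z j
    let pj ← rd p j
    let r ← split zj pj st.C (j + 1) hi
    let st ← forEach (fun l (st : Mem) => do
      let x ← rd st.C l
      let M ← wr2 st.M j l x
      let C ← wr st.C l 0
      return { st with M := M, C := C }) r.2.2 st
    let M ← wr2 st.M j j r.1
    let C ← wr st.C j r.2.1
    return { st with M := M, C := C }) (downTo hi lo) (fun j _ s => by
      obtain ⟨h1, h2⟩ := split_steps_le (z j) (p j) s.C (lo := j + 1) hS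
      have h3 := forEach_steps_le (B := 3) (body := fun l (st : Mem) => do
        let x ← rd st.C l
        let M ← wr2 st.M j l x
        let C ← wr st.C l 0
        return { st with M := M, C := C }) (split (z j) (p j) s.C (j + 1) hi).val.2.2
        (fun i _ s => by simp) s
      simp only [bind_steps, rd_steps, rd_val, wr2_steps, wr_steps, pure_steps]
      omega) st
  have h2 := fun st => forEach_steps_le (B := 4) (body := fun l (st : Mem) => do
      let x ← rd st.C l
      let zero ← eqR x 0
      if zero then
        return st
      else
        let M ← wr2 st.M (lo - 1) l x
        let C ← wr st.C l 0
        return { st with M := M, C := C }) (upTo lo hi)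
    (fun l _ s => by by_cases h : s.C l = 0 <;> simp [h]) st
  rw [length_downTo] at h1
  simp only [length_upTo] at h2
  have h3 : (hi - lo) * (8 * S + 8 + 1) ≤ S * (8 * S + 8 + 1) := Nat.mul_le_mul_right _ (by omega)
  have h5 : S ≤ S ^ 2 := Nat.le_self_pow two_ne_zero S
  have h6 : S * (8 * S + 8 + 1) = 8 * S ^ 2 + 9 * S := by ring
  unfold qSegment
  simp only [bind_steps, tick_steps]
  split_ifs
  · simp only [pure_steps]
    omega
  · refine (Nat.add_le_add h1 (Nat.add_le_add_left (h2 _) 1)).trans ?_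
    omega

theorem mainLoop_steps_le (p q z : ℕ → ℝ) (hS1 : 1 ≤ S) (l : List ℕ) :
    ∀ (odd : Bool) (hi : ℕ) (st : Mem), hi ≤ S → (∀ i ∈ l, i ≤ S) →
      (mainLoop p q z odd hi l st).steps ≤ l.length * (25 * S ^ 2 + 1) + 1 := by
  induction l with
  | nil => intro odd hi st _ _; simp [mainLoop]
  | cons i l ih =>
    intro odd hi st h1 h2
    have h3 := ih (!odd) i (if odd then pSegment z q hi i st else qSegment z p hi i st).val
      (h2 i (by simp)) fun j hj => h2 j (by simp [hj])
    have h4 : (if odd then pSegment z q hi i st else qSegment z p hi i st).steps ≤ 25 * S ^ 2 := by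
      split_ifs
      · exact pSegment_steps_le z q h1 hS1 st
      · exact qSegment_steps_le z p h1 hS1 st
    have e : (mainLoop p q z odd hi (i :: l) st).steps =
        1 + ((if odd then pSegment z q hi i st else qSegment z p hi i st).steps +
          (mainLoop p q z (!odd) i l
            (if odd then pSegment z q hi i st else qSegment z p hi i st).val).steps) := by
      cases odd <;> rfl
    rw [e, List.length_cons]
    have h5 : (l.length + 1) * (25 * S ^ 2 + 1) =
      l.length * (25 * S ^ 2 + 1) + (25 * S ^ 2 + 1) := by ring
    omega

theorem orderedMinEntropyJoint_steps_le (p q : ℕ → ℝ) (hN : N + 1 ≤ S) :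
    (orderedMinEntropyJoint N p q).steps ≤ 60 * S ^ 3 := by
  have h1 := suffixSums_steps_le N p
  have h2 := suffixSums_steps_le N q
  have h3 := inversionPoints_steps_le (suffixSums N p).val (suffixSums N q).val true N
  obtain ⟨h4, h5⟩ := inversionPoints_val_le (suffixSums N p).val (suffixSums N q).val true N
  have h6 := glb_steps_le N p q
  have h7 := mainLoop_steps_le p q (glb N p q).val (S := S) (by omega)
    (inversionPoints (suffixSums N p).val (suffixSums N q).val true N).val true (N + 1)
    ⟨fun _ _ => 0, fun _ => 0, fun _ => 0⟩ hN (fun i hi => (h5 i hi).trans hN)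
  have h8 := Nat.mul_le_mul_right (25 * S ^ 2 + 1) (h4.trans hN)
  have h9 : S * (25 * S ^ 2 + 1) = 25 * S ^ 3 + S := by ring
  have h10 : N * N ≤ S ^ 2 := by
    rw [pow_two]; exact Nat.mul_le_mul (by omega) (by omega)
  have h11 : S ≤ S ^ 3 := Nat.le_self_pow three_ne_zero S
  have h12 : S ^ 2 ≤ S ^ 3 := Nat.pow_le_pow_right (by omega) (by omega)
  simp only [orderedMinEntropyJoint, bind_steps, newMatrix_steps, newArray_steps, newMatrix_val,
    newArray_val, pure_steps]
  omega

theorem minEntropyJoint_steps_le (p q : ℕ → ℝ) (hN : N + 1 ≤ S) :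
    (minEntropyJoint N p q).steps ≤ 70 * S ^ 3 := by
  have h1 := needsSwap_steps_le p q N
  have h2 := orderedMinEntropyJoint_steps_le p q hN
  have h3 := orderedMinEntropyJoint_steps_le q p hN
  have h10 : N * N ≤ S ^ 2 := by
    rw [pow_two]; exact Nat.mul_le_mul (by omega) (by omega)
  have h11 : S ≤ S ^ 3 := Nat.le_self_pow three_ne_zero S
  have h12 : S ^ 2 ≤ S ^ 3 := Nat.pow_le_pow_right (by omega) (by omega)
  simp only [minEntropyJoint, bind_steps]
  split_ifs
  · simp only [bind_steps, transposeM_steps]; omega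
  · omega

end StepsTwo

/-! ### Running time for many distributions -/

section StepsTree

variable {n S : ℕ}

theorem insertDesc_steps_le (e : Entry n) (l : List (Entry n)) :
    (insertDesc e l).steps ≤ 2 * l.length + 1 := by
  induction l with
  | nil => simp [insertDesc]
  | cons f l ih =>
    by_cases h : e.1 < f.1
    · simp [insertDesc, h]; omega
    · simp [insertDesc, h]; omega

theorem sortDesc_steps_le (l : List (Entry n)) :
    (sortDesc l).steps ≤ l.length * (2 * l.length + 2) + 1 := by
  induction l with
  | nil => simp [sortDesc]
  | cons e l ih =>
    have h := insertDesc_steps_le e (sortDesc l).val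
    rw [(sortDesc_perm l).length_eq] at h
    simp only [sortDesc, bind_steps, tick_steps, List.length_cons]
    have h2 : (l.length + 1) * (2 * (l.length + 1) + 2) =
      l.length * (2 * l.length + 2) + 4 * l.length + 4 := by ring
    omega

theorem collectRow_le (M : ℕ → ℕ → ℝ) (s : ℕ) {u : List (Fin n)} (hu : u.length ≤ S)
    {l : List (Entry n)} (hl : ∀ e ∈ l, e.2.length ≤ S) (t : ℕ) :
    (collectRow M s u t l).steps ≤ l.length * (2 * S + 4) + 1 ∧
      (collectRow M s u t l).val.length ≤ l.length := by
  induction l generalizing t with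
  | nil => simp [collectRow]
  | cons f l ih =>
    obtain ⟨h1, h2⟩ := ih (fun e he => hl e (by simp [he])) (t + 1)
    have h3 := hl f (by simp)
    have h4 : (l.length + 1) * (2 * S + 4) = l.length * (2 * S + 4) + (2 * S + 4) := by ring
    by_cases h : M s t = 0
    · simp only [collectRow, bind_steps, tick_steps, rd2_steps, eqR_steps, bind_val, rd2_val,
        eqR_val, h, decide_true, if_true, List.length_cons]
      omega
    · simp only [collectRow, bind_steps, tick_steps, rd2_steps, eqR_steps, bind_val, rd2_val,
        eqR_val, h, decide_false, Bool.false_eq_true, if_false, concat, pure_steps, pure_val,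
        List.length_cons]
      omega

theorem collect_le (M : ℕ → ℕ → ℝ) {b : List (Entry n)} (hb : ∀ e ∈ b, e.2.length ≤ S)
    (hbS : b.length ≤ S) {l : List (Entry n)} (hl : ∀ e ∈ l, e.2.length ≤ S) (s : ℕ) :
    (collect M b s l).steps ≤ l.length * (S * (2 * S + 5) + 2) + 1 ∧
      (collect M b s l).val.length ≤ l.length * S := by
  induction l generalizing s with
  | nil => simp [collect]
  | cons f l ih =>
    obtain ⟨h1, h2⟩ := ih (fun e he => hl e (by simp [he])) (s + 1)
    obtain ⟨h3, h4⟩ := collectRow_le M s (hl f (by simp)) hb 1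
    have h5 := Nat.mul_le_mul_right (2 * S + 4) hbS
    have h6 : (l.length + 1) * (S * (2 * S + 5) + 2) =
      l.length * (S * (2 * S + 5) + 2) + (S * (2 * S + 4) + S + 2) := by ring
    have h7 : (l.length + 1) * S = l.length * S + S := by ring
    simp only [collect, bind_steps, tick_steps, bind_val, pure_val, pure_steps, List.length_cons,
      List.length_append]
    omega

theorem mergeNode_steps_le {a b : List (Entry n)} (ha : ∀ e ∈ a, e.2.length ≤ S)
    (hb : ∀ e ∈ b, e.2.length ≤ S) (haS : a.length + 1 ≤ S) (hbS : b.length + 1 ≤ S) :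
    (mergeNode a b).steps ≤ 100 * S ^ 4 := by
  set N := max a.length b.length with hN
  set M := (minEntropyJoint N (load N a).val (load N b).val).val with hM
  have h1 := minEntropyJoint_steps_le (load N a).val (load N b).val (N := N) (S := S) (by omega)
  obtain ⟨h2, h3⟩ := collect_le M hb (by omega) ha 1
  have h4 := sortDesc_steps_le (collect M b 1 a).val
  have e : (mergeNode a b).steps = (a.length + 1) + ((b.length + 1) + (1 + ((N + 1) + ((N + 1) +
      ((minEntropyJoint N (load N a).val (load N b).val).steps + ((collect M b 1 a).steps +
      (sortDesc (collect M b 1 a).val).steps)))))) := rfl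
  have h5 : a.length * (S * (2 * S + 5) + 2) ≤ S * (S * (2 * S + 5) + 2) :=
    Nat.mul_le_mul_right _ (by omega)
  have h6 : (collect M b 1 a).val.length ≤ S * S :=
    h3.trans (Nat.mul_le_mul_right _ (by omega))
  have h7 : (collect M b 1 a).val.length * (2 * (collect M b 1 a).val.length + 2) ≤
      (S * S) * (2 * (S * S) + 2) := Nat.mul_le_mul h6 (by omega)
  have h8 : S * (S * (2 * S + 5) + 2) = 2 * S ^ 3 + 5 * S ^ 2 + 2 * S := by ring
  have h9 : (S * S) * (2 * (S * S) + 2) = 2 * S ^ 4 + 2 * S ^ 2 := by ring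
  have p1 : S ≤ S ^ 4 := Nat.le_self_pow four_ne_zero S
  have p2 : S ^ 2 ≤ S ^ 4 := Nat.pow_le_pow_right (by omega) (by omega)
  have p3 : S ^ 3 ≤ S ^ 4 := Nat.pow_le_pow_right (by omega) (by omega)
  rw [e]
  omega

theorem leaves_steps_le (l : List (Fin n → ℝ)) :
    (leaves l).steps ≤ l.length * (2 * n ^ 2 + 3 * n + 4) + 1 := by
  induction l with
  | nil => simp [leaves]
  | cons p l ih =>
    have h := sortDesc_steps_le (leaf p).val
    have hl : (leaf p).val.length = n := by simp [leaf]
    rw [hl] at h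
    have e : (leaves (p :: l)).steps =
      1 + ((n + 1) + ((sortDesc (leaf p).val).steps + ((leaves l).steps + 0))) := rfl
    have h2 : (l.length + 1) * (2 * n ^ 2 + 3 * n + 4) =
      l.length * (2 * n ^ 2 + 3 * n + 4) + (n * (2 * n + 2) + n + 4) := by ring
    rw [e, List.length_cons]
    omega

theorem truncate_steps (m : ℕ) (l : List (Entry n)) :
    (truncate m l).steps = l.length * (m + 1) + 1 := by
  induction l with
  | nil => simp [truncate]
  | cons e l ih => simp [truncate, ih]; ring

theorem writeEntries_steps {m : ℕ} (l : List (Entry n)) (M : (Fin m → Fin n) → ℝ) :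
    (writeEntries l M).steps = l.length * (m + 3) + 1 := by
  induction l generalizing M with
  | nil => simp [writeEntries]
  | cons e l ih => simp [writeEntries, ih]; ring

variable {D : ℕ → Fin n → ℝ}

theorem mergeLevel_steps_le {k : ℕ} (hS : 2 ^ k * n + 1 ≤ S) (hS' : 2 ^ k ≤ S) (r : ℕ) :
    ∀ {off : ℕ} {l : List (List (Entry n))}, l.length = 2 * r → IsLevel D k off l →
    (mergeLevel l).steps ≤ r * (100 * S ^ 4 + 1) + 1 := by
  induction r with
  | zero =>
    intro off l hl _
    obtain rfl := List.length_eq_zero_iff.1 hl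
    simp [mergeLevel]
  | succ r ih =>
    intro off l hl h
    match l, hl, h with
    | a :: b :: l, hl, h =>
      have h1 := ih (by simpa [mul_add] using hl) h.2.2
      have h2 := mergeNode_steps_le (S := S)
        (fun e he => (h.1.index_length e he).trans_le hS')
        (fun e he => (h.2.1.index_length e he).trans_le hS')
        ((Nat.add_le_add_right h.1.length_le 1).trans hS)
        ((Nat.add_le_add_right h.2.1.length_le 1).trans hS)
      have h3 : (r + 1) * (100 * S ^ 4 + 1) = r * (100 * S ^ 4 + 1) + (100 * S ^ 4 + 1) := by ring
      have e : (mergeLevel (a :: b :: l)).steps =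
        1 + ((mergeNode a b).steps + ((mergeLevel l).steps + 0)) := rfl
      omega
    | [a], hl, _ => simp at hl; omega

theorem mergeLevels_steps_le {κ : ℕ} (hn : 1 ≤ n) (hS : 2 ^ κ * n + 1 ≤ S) (r : ℕ) :
    ∀ {k off : ℕ} {l : List (List (Entry n))}, k + r ≤ κ → l.length = 2 ^ r → IsLevel D k off l →
    (mergeLevels r l).steps ≤ r * (S * (100 * S ^ 4 + 1) + 2) + 1 := by
  induction r with
  | zero => intro k off l _ _ _; simp [mergeLevels]
  | succ r ih =>
    intro k off l hk hl h
    have hl' : l.length = 2 * 2 ^ r := by rw [hl, pow_succ, mul_comm]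
    obtain ⟨h1, h2⟩ := isLevel_mergeLevel (2 ^ r) hl' h
    have h3 := ih (k := k + 1) (by omega) h2 h1
    have h4 : 2 ^ k * n ≤ 2 ^ κ * n :=
      Nat.mul_le_mul_right _ (Nat.pow_le_pow_right (by omega) (by omega))
    have h5 : ∀ j, 2 ^ j ≤ 2 ^ j * n := fun j => Nat.le_mul_of_pos_right _ hn
    have h6 := mergeLevel_steps_le (S := S) (by omega) (by have := h5 k; omega) (2 ^ r) hl' h
    have h7 : 2 ^ r ≤ S := by
      have := h5 r
      have : 2 ^ r * n ≤ 2 ^ κ * n :=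
        Nat.mul_le_mul_right _ (Nat.pow_le_pow_right (by omega) (by omega))
      omega
    have h8 := Nat.mul_le_mul_right (100 * S ^ 4 + 1) h7
    have h9 : (r + 1) * (S * (100 * S ^ 4 + 1) + 2) =
      r * (S * (100 * S ^ 4 + 1) + 2) + (S * (100 * S ^ 4 + 1) + 2) := by ring
    simp only [mergeLevels, bind_steps, tick_steps]
    omega

end StepsTree

theorem two_pow_clog_le {m : ℕ} (hm : 1 ≤ m) : 2 ^ Nat.clog 2 m ≤ 2 * m := by
  rcases hm.eq_or_lt with rfl | h
  · simp
  · have h1 : Nat.clog 2 m ≠ 0 := (Nat.clog_pos one_lt_two h).ne'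
    obtain ⟨k, hk⟩ := Nat.exists_eq_succ_of_ne_zero h1
    have h2 : 2 ^ k < m := (Nat.lt_clog_iff_pow_lt one_lt_two).1 (by omega)
    rw [hk, pow_succ]
    omega

section StepsTotal

variable {m n : ℕ} [NeZero m] {p : Fin m → Fin n → ℝ}

theorem kMinEntropy_steps_le (hp : ∀ i, IsOrderedDist (p i)) :
    (kMinEntropyEntries p).steps ≤ 120 * 3 ^ 6 * (m * n) ^ 6 ∧
      (kMinEntropyJoint p).steps ≤ 120 * 3 ^ 6 * (m * n) ^ 6 + n ^ m := by
  have hm : 1 ≤ m := NeZero.one_le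
  -- The components of a distribution add up to `1`, so there is at least one.
  have hn : 1 ≤ n := by
    rcases Nat.eq_zero_or_pos n with rfl | h
    · simpa using (hp 0).2.2
    · exact h
  set κ := Nat.clog 2 m with hκ
  set S := 2 ^ κ * n + 1 with hS
  have hSmn : S ≤ 3 * (m * n) := by
    have h1 : 2 ^ κ * n ≤ 2 * m * n := Nat.mul_le_mul_right n (two_pow_clog_le hm)
    have h2 : 1 ≤ m * n := Nat.mul_pos hm hn
    have h3 : 2 * m * n = 2 * (m * n) := by ring
    rw [h3] at h1
    omega
  have hκn : 2 ^ κ ≤ 2 ^ κ * n := Nat.le_mul_of_pos_right _ hn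
  have hnκ : n ≤ 2 ^ κ * n := Nat.le_mul_of_pos_left _ (by positivity)
  have hmκ : m ≤ 2 ^ κ := Nat.le_pow_clog one_lt_two m
  have hmS : m ≤ S := hmκ.trans (by omega)
  have hκS : κ ≤ S := Nat.lt_two_pow_self.le.trans (by omega)
  have hlev := isLevel_leaves (D := fun i => p (Fin.ofNat m i)) (fun i => hp _) (2 ^ κ) 0
  simp only [zero_add] at hlev
  have h1 := leaves_steps_le (List.ofFn fun i : Fin (2 ^ κ) => p (Fin.ofNat m i))
  rw [List.length_ofFn] at h1
  have h2 := mergeLevels_steps_le (κ := κ) (S := S) hn le_rfl κ (k := 0) (by omega) hlev.2 hlev.1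
  have h3 := truncate_steps m (rootEntries p)
  have hroot : (rootEntries p).length + 1 ≤ S :=
    Nat.add_le_add_right (isNode_rootEntries hp).length_le 1
  have e1 : (kMinEntropyEntries p).steps = (m + 1) +
      ((leaves (List.ofFn fun i : Fin (2 ^ κ) => p (Fin.ofNat m i))).steps +
      ((mergeLevels κ (leaves (List.ofFn fun i : Fin (2 ^ κ) => p (Fin.ofNat m i))).val).steps +
      (truncate m (rootEntries p)).steps)) := rfl
  have e2 : (kMinEntropyJoint p).steps = (kMinEntropyEntries p).steps +
      (n ^ m + (writeEntries (m := m) (truncate m (rootEntries p)).val fun _ => 0).steps) := rfl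
  have h4 := writeEntries_steps (m := m) (truncate m (rootEntries p)).val fun _ => 0
  rw [show (truncate m (rootEntries p)).val.length = (rootEntries p).length by
    simp [truncate_val]] at h4
  have b1 : 2 ^ κ * (2 * n ^ 2 + 3 * n + 4) ≤ S * (2 * S ^ 2 + 3 * S + 4) := by
    have hnS : n ≤ S := by omega
    have : 2 ^ κ ≤ S := by omega
    gcongr
  have b2 : κ * (S * (100 * S ^ 4 + 1) + 2) ≤ S * (S * (100 * S ^ 4 + 1) + 2) :=
    Nat.mul_le_mul_right _ hκS
  have b3 : (rootEntries p).length * (m + 1) ≤ S * (S + 1) :=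
    Nat.mul_le_mul (by omega) (by omega)
  have b4 : (rootEntries p).length * (m + 3) ≤ S * (S + 3) :=
    Nat.mul_le_mul (by omega) (by omega)
  have c1 : S * (2 * S ^ 2 + 3 * S + 4) = 2 * S ^ 3 + 3 * S ^ 2 + 4 * S := by ring
  have c2 : S * (S * (100 * S ^ 4 + 1) + 2) = 100 * S ^ 6 + S ^ 2 + 2 * S := by ring
  have c3 : S * (S + 1) = S ^ 2 + S := by ring
  have c4 : S * (S + 3) = S ^ 2 + 3 * S := by ring
  have hS2 : 2 ≤ S := by
    have : 1 ≤ 2 ^ κ := Nat.one_le_two_pow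
    omega
  -- With `2 ≤ S` the terms of lower degree take up only a small part of `S ^ 6`.
  have p1 : 2 ^ 5 * S ≤ S ^ 5 * S := Nat.mul_le_mul_right _ (Nat.pow_le_pow_left hS2 5)
  have p2 : 2 ^ 4 * S ^ 2 ≤ S ^ 4 * S ^ 2 := Nat.mul_le_mul_right _ (Nat.pow_le_pow_left hS2 4)
  have p3 : 2 ^ 3 * S ^ 3 ≤ S ^ 3 * S ^ 3 := Nat.mul_le_mul_right _ (Nat.pow_le_pow_left hS2 3)
  rw [← pow_succ] at p1
  rw [← pow_add] at p2 p3
  norm_num at p1 p2 p3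
  have hfin : 120 * S ^ 6 ≤ 120 * 3 ^ 6 * (m * n) ^ 6 := by
    rw [mul_assoc, ← mul_pow]
    exact Nat.mul_le_mul_left _ (Nat.pow_le_pow_left hSmn 6)
  have t1 : (kMinEntropyEntries p).steps ≤ 110 * S ^ 6 := by
    rw [e1, h3]
    omega
  refine ⟨?_, ?_⟩
  · omega
  · rw [e2, h4]
    omega

end StepsTotal

end MinEntropy

theorem theorem4 :
    (∀ (m n : ℕ) [NeZero m] (p : Fin m → Fin n → ℝ), (∀ i, MinEntropy.IsOrderedDist (p i)) →
      MinEntropy.IsJoint p (MinEntropy.kMinEntropyJoint p).val ∧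
      (∃ Mstar, MinEntropy.IsMinEntropyJoint p Mstar) ∧
      ∀ Mstar, MinEntropy.IsMinEntropyJoint p Mstar →
        MinEntropy.H (MinEntropy.kMinEntropyJoint p).val ≤
          MinEntropy.H Mstar + (⌈Real.logb 2 (m : ℝ)⌉ : ℝ)) ∧
    ∃ C d : ℕ, ∀ (m n : ℕ) [NeZero m] (p : Fin m → Fin n → ℝ),
      (∀ i, MinEntropy.IsOrderedDist (p i)) →
        (MinEntropy.kMinEntropyEntries p).steps ≤ C * (m * n) ^ d ∧
        (MinEntropy.kMinEntropyJoint p).steps ≤ C * (m * n) ^ d + n ^ m := by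
  refine ⟨fun m n _ p hp => ⟨MinEntropy.kMinEntropyJoint_isJoint hp,
    MinEntropy.exists_isMinEntropyJoint hp (MinEntropy.kMinEntropyJoint_isJoint hp),
    fun Mstar hM => MinEntropy.H_kMinEntropyJoint_le hp hM.1⟩,
    120 * 3 ^ 6, 6, fun m n _ p hp => MinEntropy.kMinEntropy_steps_le hp⟩
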